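/- Theorem. A graph $G$ with $q$ edges is called $\Gamma$-harmonious, for an (additive) abelian group $\Gamma$ of order $q$, if there is an injection $f:V(G)\to\Gamma$ (a $\Gamma$-harmonious labeling) such that the induced edge labels $w(xy)=f(x)+f(y)$ form a bijection from $E(G)$ onto $\Gamma$. For integers $n\ge 3$ and $k\ge 0$ let the superwheel $SW_{k,n}$ be the graph obtained from the cycle $C_n$ by adding $k$ pairwise nonadjacent vertices (hubs), each adjacent to every vertex of $C_n$; it has $n(k+1)$ edges. Let $\Gamma$ be an abelian group of order $n(k+1)$ that has a subgroup $H$ of order $n$ such that either $n$ is odd, or $n$ is even and $H$ has a subgroup isomorphic to $\mathbb Z_2\oplus\mathbb Z_{2s}$ for some integer $s\ge 2$. Then $SW_{k,n}$ is $\Gamma$-harmonious. More precisely, there are an $H$-harmonious labeling $(h_1,\dots,h_n)$ of $C_n$ and elements $g_1,\dots,g_k\in\Gamma$ whose cosets $g_1+H,\dots,g_k+H$ are exactly the $k$ cosets of $H$ in $\Gamma$ other than $H$, each occurring once, such that labeling the cycle vertices by $h_1,\dots,h_n$ and the hubs by $g_1,\dots,g_k$ is a $\Gamma$-harmonious labeling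 of $SW_{k,n}$. -/

import Mathlib

/-- The label `f x + f y` that a vertex labeling `f` induces on the unordered pair `{x, y}`. -/
def edgeLabel {V Γ : Type*} [AddCommGroup Γ] (f : V → Γ) : Sym2 V → Γ :=
  Sym2.lift ⟨fun x y => f x + f y, fun x y => add_comm (f x) (f y)⟩

/-- `f` is a `Γ`-harmonious labeling of `G`: it is injective on vertices and the induced edge
labels form a bijection from the edge set of `G` onto `Γ` (so `Γ` has as many elements as `G`
has edges). -/
def IsHarmoniousLabeling {V Γ : Type*} [AddCommGroup Γ] (G : SimpleGraph V) (f : V → Γ) : Prop :=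
  Function.Injective f ∧ Set.BijOn (edgeLabel f) G.edgeSet Set.univ

/-- The graph `G` is `Γ`-harmonious. -/
def IsHarmonious {V : Type*} (G : SimpleGraph V) (Γ : Type*) [AddCommGroup Γ] : Prop :=
  ∃ f : V → Γ, IsHarmoniousLabeling G f

/-- The superwheel `SW_{k,n}`: the cycle `C_n` together with `k` pairwise nonadjacent hub
vertices, each adjacent to every vertex of the cycle. -/
def superwheel (k n : ℕ) : SimpleGraph (Fin n ⊕ Fin k) :=
  (SimpleGraph.cycleGraph n ⊕g (⊥ : SimpleGraph (Fin k))) ⊔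
    completeBipartiteGraph (Fin n) (Fin k)

/-- The condition on an abelian group `A` of order `n`: either `n` is odd, or `n` is even and
`A` has a subgroup isomorphic to `Z_2 ⊕ Z_{2s}` for some `s ≥ 2`. -/
def CycleCondition (A : Type*) [AddCommGroup A] (n : ℕ) : Prop :=
  Odd n ∨ (Even n ∧ ∃ s : ℕ, 2 ≤ s ∧ ∃ K : AddSubgroup A,
    Nonempty (K ≃+ ZMod 2 × ZMod (2 * s)))

/-! The labels separate by cosets: cycle edges receive sums in `H`, while the edges at the hub
labelled `g j` fill the coset of `g j` once each. Everything therefore reduces to arranging `H` in a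
harmonic cycle (`CycleCondition.harmonic`).

Harmonicity passes from a kernel to the whole group when the quotient has odd order
(`Harmonic.of_ker_of_odd`). This settles odd order. For even order it leaves the Sylow 2-subgroup P
if P is not elementary, and P × ℤ/p for an odd prime p if it is. The hypothesis makes P noncyclic;
since 2s > 2 it also prevents `H` from being an elementary 2-group, in which distinct elements never
sum to 0.

For the remaining groups the induction carries the stronger property `HasSwitch`. Let A → B have as
kernel the additive group of a field F of characteristic 2 with at least four elements, and let β
generate F*. A cycle of B is lifted to the layers e(x) + β^r g(x), with g a nonzero colouring, and
to the zero layer e(x). If the colours of a step differ, its copies in the nonzero layers produce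
all nonzero kernel translates of its sum; the zero layer produces the others. A switch says how to
join the layers into one cycle without losing a sum, and a suitable colouring yields a switch in A
(`isHarmonicCycle_lift`, `HasSwitch.lift`).

The induction starts from explicit small cycles, a doubling construction for ℤ/2 × ℤ/2^m, and
consecutive residues in ℤ/p for p ≥ 7. -/

/-! ### Harmonic groups, and the reduction of superwheels to them. -/

/-- A finite abelian group is harmonic if its elements can be arranged in a cycle, given here as a
periodic sequence, whose consecutive sums run through the whole group. -/
def Harmonic (A : Type*) [AddCommGroup A] : Prop :=
  ∃ a : ℕ → A, (∀ i, a (i + Nat.card A) = a i) ∧ Function.Surjective a ∧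
    Function.Surjective fun i => a i + a (i + 1)

theorem periodic_mod {α : Type*} {a : ℕ → α} {n : ℕ} (h : ∀ i, a (i + n) = a i) (i : ℕ) :
    a (i % n) = a i :=
  (show Function.Periodic a n from h).map_mod_nat i

theorem Harmonic.of_addEquiv {A B : Type*} [AddCommGroup A] [AddCommGroup B] (f : A ≃+ B)
    (h : Harmonic A) : Harmonic B := by
  obtain ⟨a, hp, hs, ht⟩ := h
  refine ⟨fun i => f (a i), fun i => ?_, f.surjective.comp hs, fun y => ?_⟩
  · simp only [← Nat.card_congr f.toEquiv, hp]
  · obtain ⟨i, hi⟩ := ht (f.symm y)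
    exact ⟨i, by simp only at hi ⊢; rw [← map_add, hi, f.apply_symm_apply]⟩

theorem cycleGraph_edge_eq (n : ℕ) (e : Sym2 (Fin (n + 2)))
    (he : e ∈ (SimpleGraph.cycleGraph (n + 2)).edgeSet) : ∃ i : Fin (n + 2), e = s(i, i + 1) := by
  induction e with
  | _ x y =>
    rw [SimpleGraph.mem_edgeSet, SimpleGraph.cycleGraph_adj] at he
    rcases he with h | h
    · exact ⟨y, by rw [← h, add_sub_cancel, Sym2.eq_swap]⟩
    · exact ⟨x, by rw [← h, add_sub_cancel]⟩

theorem cycleGraph_edge_mem (n : ℕ) (i : Fin (n + 2)) :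
    s(i, i + 1) ∈ (SimpleGraph.cycleGraph (n + 2)).edgeSet := by
  rw [SimpleGraph.mem_edgeSet, SimpleGraph.cycleGraph_adj]
  right; simp

theorem Harmonic.exists_labeling {A : Type*} [AddCommGroup A] [Finite A] {n : ℕ} (hn : 2 ≤ n)
    (hA : Nat.card A = n) (h : Harmonic A) :
    ∃ f : Fin n → A, IsHarmoniousLabeling (SimpleGraph.cycleGraph n) f := by
  obtain ⟨a, hp, hs, ht⟩ := h
  rw [hA] at hp
  obtain ⟨m, rfl⟩ : ∃ m, n = m + 2 := ⟨n - 2, by omega⟩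
  have hsucc : ∀ i : Fin (m + 2), a (i + 1 : Fin (m + 2)) = a ((i : ℕ) + 1) := by
    intro i
    rw [← periodic_mod hp ((i : ℕ) + 1), Fin.val_add, Fin.val_one]
  have hcard : Nat.card (Fin (m + 2)) = Nat.card A := by simp [hA]
  have hf : Function.Surjective fun i : Fin (m + 2) => a i := by
    intro y
    obtain ⟨i, hi⟩ := hs y
    exact ⟨⟨i % (m + 2), Nat.mod_lt _ (by omega)⟩, by simpa [periodic_mod hp] using hi⟩
  have hlab : ∀ i : Fin (m + 2),
      edgeLabel (fun i : Fin (m + 2) => a i) s(i, i + 1) = a i + a ((i : ℕ) + 1) := by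
    intro i
    simp only [edgeLabel, Sym2.lift_mk]
    rw [hsucc]
  have hg : Function.Surjective fun i : Fin (m + 2) => a i + a ((i : ℕ) + 1) := by
    intro y
    obtain ⟨i, hi⟩ := ht y
    refine ⟨⟨i % (m + 2), Nat.mod_lt _ (by omega)⟩, ?_⟩
    simp only [periodic_mod hp] at hi ⊢
    rw [← hi, ← periodic_mod hp (i % (m + 2) + 1), ← periodic_mod hp (i + 1)]
    simp
  have hf' := (Nat.bijective_iff_surjective_and_card _).2 ⟨hf, hcard⟩
  have hg' := (Nat.bijective_iff_surjective_and_card _).2 ⟨hg, hcard⟩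
  refine ⟨fun i => a i, hf'.1, fun _ _ => Set.mem_univ _, ?_, ?_⟩
  · intro e he e' he' hee
    obtain ⟨i, rfl⟩ := cycleGraph_edge_eq m e he
    obtain ⟨j, rfl⟩ := cycleGraph_edge_eq m e' he'
    rw [hlab, hlab] at hee
    rw [hg'.1 hee]
  · intro y _
    obtain ⟨i, hi⟩ := hg y
    exact ⟨s(i, i + 1), cycleGraph_edge_mem m i, by rw [hlab]; exact hi⟩

theorem exists_coset_representatives {Γ : Type*} [AddCommGroup Γ] {k n : ℕ} (hn : 0 < n)
    (hΓ : Nat.card Γ = n * (k + 1)) (H : AddSubgroup Γ) (hH : Nat.card H = n) :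
    ∃ g : Fin k → Γ,
      Set.BijOn (fun j => (QuotientAddGroup.mk (g j) : Γ ⧸ H)) Set.univ {0}ᶜ := by
  classical
  have hcard : Nat.card (Γ ⧸ H) = k + 1 := by
    have h1 := AddSubgroup.card_eq_card_quotient_mul_card_addSubgroup H
    rw [hΓ, hH, mul_comm] at h1
    exact (Nat.eq_of_mul_eq_mul_right hn h1).symm
  have : Finite (Γ ⧸ H) := Nat.finite_of_card_ne_zero (by omega)
  have h2 : Nat.card ({0}ᶜ : Set (Γ ⧸ H)) = k := by
    have := Set.ncard_add_ncard_compl ({0} : Set (Γ ⧸ H))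
    rw [Set.ncard_singleton, hcard] at this
    rw [Nat.card_coe_set_eq]; omega
  obtain ⟨f⟩ : Nonempty (Fin k ≃ ({0}ᶜ : Set (Γ ⧸ H))) :=
    ⟨(finCongr h2.symm).trans (Finite.equivFin _).symm⟩
  refine ⟨fun j => (f j : Γ ⧸ H).out, ?_⟩
  have : (fun j => (QuotientAddGroup.mk (f j : Γ ⧸ H).out : Γ ⧸ H)) = fun j => (f j : Γ ⧸ H) := by
    funext j; exact Quotient.out_eq' _
  rw [this]
  refine ⟨fun j _ => (f j).2, fun i _ j _ h => f.injective (Subtype.ext h), fun y hy => ?_⟩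
  exact ⟨f.symm ⟨y, hy⟩, trivial, by simp⟩

theorem superwheel_edge_cases {k n : ℕ} (e : Sym2 (Fin n ⊕ Fin k))
    (he : e ∈ (superwheel k n).edgeSet) :
    (∃ d ∈ (SimpleGraph.cycleGraph n).edgeSet, e = d.map Sum.inl) ∨
      ∃ i j, e = s(Sum.inl i, Sum.inr j) := by
  induction e with
  | _ x y =>
    rw [SimpleGraph.mem_edgeSet, superwheel, SimpleGraph.sup_adj] at he
    rcases x with x | x <;> rcases y with y | y <;> simp at he
    · exact Or.inl ⟨s(x, y), he, by simp⟩
    · exact Or.inr ⟨x, y, rfl⟩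
    · exact Or.inr ⟨y, x, Sym2.eq_swap⟩

/-- A harmonious labeling of the cycle by `H` and representatives of the other cosets of `H`
label the superwheel harmoniously. -/
theorem superwheel_labeling {k n : ℕ} {Γ : Type*} [AddCommGroup Γ] (H : AddSubgroup Γ)
    (hfin : Finite H) (hH : Nat.card H = n) {h : Fin n → H} {g : Fin k → Γ}
    (hh : IsHarmoniousLabeling (SimpleGraph.cycleGraph n) h)
    (hg : Set.BijOn (fun j => (QuotientAddGroup.mk (g j) : Γ ⧸ H)) Set.univ {0}ᶜ) :
    IsHarmoniousLabeling (superwheel k n) (Sum.elim (fun i => (h i : Γ)) g) := by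
  have hbij : Function.Bijective h :=
    (Nat.bijective_iff_injective_and_card _).2 ⟨hh.1, by simp [hH]⟩
  have hg0 : ∀ j, (QuotientAddGroup.mk (g j) : Γ ⧸ H) ≠ 0 := fun j => hg.1 (Set.mem_univ j)
  have hh0 : ∀ x : H, (QuotientAddGroup.mk (x : Γ) : Γ ⧸ H) = 0 := fun x =>
    (QuotientAddGroup.eq_zero_iff _).2 x.2
  have hginj : ∀ i j, (QuotientAddGroup.mk (g i) : Γ ⧸ H) = QuotientAddGroup.mk (g j) → i = j :=
    fun i j hij => hg.2.1 (Set.mem_univ i) (Set.mem_univ j) hij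
  have hcyc : ∀ d : Sym2 (Fin n), edgeLabel (Sum.elim (fun i => (h i : Γ)) g) (d.map Sum.inl) =
      ((edgeLabel h d : H) : Γ) := by
    intro d
    induction d with
    | _ x y => simp [edgeLabel]
  have hhub : ∀ i j, edgeLabel (Sum.elim (fun i => (h i : Γ)) g) s(Sum.inl i, Sum.inr j) =
      h i + g j := by
    intro i j; simp [edgeLabel]
  -- The coset of an edge label identifies the hub, or shows that the edge lies on the cycle; inside
  -- a coset, `h` is a bijection onto `H`.
  have hhubq : ∀ i j, (QuotientAddGroup.mk ((h i : Γ) + g j) : Γ ⧸ H) = QuotientAddGroup.mk (g j) := by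
    intro i j
    rw [QuotientAddGroup.mk_add, hh0, zero_add]
  refine ⟨?_, fun _ _ => Set.mem_univ _, ?_, ?_⟩
  · rintro (x | x) (y | y) hxy
    · simp only [Sum.elim_inl] at hxy
      rw [hh.1 (Subtype.ext hxy)]
    · simp only [Sum.elim_inl, Sum.elim_inr] at hxy
      exact absurd (by rw [← hxy, hh0]) (hg0 y)
    · simp only [Sum.elim_inl, Sum.elim_inr] at hxy
      exact absurd (by rw [hxy, hh0]) (hg0 x)
    · simp only [Sum.elim_inr] at hxy
      rw [hginj x y (by rw [hxy])]
  · intro e he e' he' hee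
    rcases superwheel_edge_cases e he with ⟨d, hd, rfl⟩ | ⟨i, j, rfl⟩ <;>
      rcases superwheel_edge_cases e' he' with ⟨d', hd', rfl⟩ | ⟨i', j', rfl⟩
    · rw [hcyc, hcyc] at hee
      rw [hh.2.2.1 hd hd' (Subtype.ext hee)]
    · rw [hcyc, hhub] at hee
      exact absurd (by rw [← hhubq i' j', ← hee, hh0]) (hg0 j')
    · rw [hcyc, hhub] at hee
      exact absurd (by rw [← hhubq i j, hee, hh0]) (hg0 j)
    · rw [hhub, hhub] at hee
      obtain rfl : j = j' := hginj _ _ (by rw [← hhubq i j, hee, hhubq])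
      rw [hh.1 (Subtype.ext (add_right_cancel hee))]
  · intro y _
    by_cases hy : y ∈ H
    · obtain ⟨d, hd, hdy⟩ := hh.2.2.2 (Set.mem_univ (⟨y, hy⟩ : H))
      refine ⟨d.map Sum.inl, ?_, by rw [hcyc, hdy]⟩
      induction d with
      | _ a b =>
        rw [Sym2.map_mk, SimpleGraph.mem_edgeSet, superwheel, SimpleGraph.sup_adj]
        left; simpa using hd
    · obtain ⟨j, -, hj⟩ := hg.2.2 (show (QuotientAddGroup.mk y : Γ ⧸ H) ∈ ({0}ᶜ : Set _) by
        simpa [QuotientAddGroup.eq_zero_iff] using hy)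
      have hmem : -g j + y ∈ H := QuotientAddGroup.eq.1 hj
      obtain ⟨i, hi⟩ := hbij.2 ⟨_, hmem⟩
      refine ⟨s(Sum.inl i, Sum.inr j), ?_, ?_⟩
      · rw [SimpleGraph.mem_edgeSet, superwheel, SimpleGraph.sup_adj]
        right; simp
      · rw [hhub, hi]; simp

/-! ### Quotients of odd order. -/

/-- If a surjection onto a group of odd order has harmonic kernel and harmonic target, then its
source is harmonic: run through the classes of the target cyclically, and alternate between
consecutive elements of the kernel. -/
theorem Harmonic.of_ker_of_odd {A B : Type*} [AddCommGroup A] [AddCommGroup B] [Finite A]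
    (φ : A →+ B) (hφ : Function.Surjective φ) (hK : Harmonic φ.ker) (hB : Harmonic B)
    (hodd : Odd (Nat.card B)) : Harmonic A := by
  obtain ⟨k, hkp, hks, hkt⟩ := hK
  obtain ⟨q, hqp, hqs, hqt⟩ := hB
  have : Finite B := Finite.of_surjective φ hφ
  set m := Nat.card B with hm
  set r := Nat.card φ.ker with hr
  have hm0 : 0 < m := Nat.card_pos
  have hr0 : 0 < r := Nat.card_pos
  have hcard : Nat.card A = m * r := by
    rw [AddSubgroup.card_eq_card_quotient_mul_card_addSubgroup φ.ker,
      Nat.card_congr (QuotientAddGroup.quotientKerEquivOfSurjective φ hφ).toEquiv]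
  obtain ⟨e, he⟩ := hφ.hasRightInverse
  have hker : ∀ x b, φ x = b → ∃ κ : φ.ker, x = e b + κ := by
    intro x b hx
    exact ⟨⟨x - e b, by rw [AddMonoidHom.mem_ker, map_sub, he, hx, sub_self]⟩, by simp⟩
  let x : ℕ → A := fun i => e (q i) + k (i / m + i % m % 2)
  have hx : ∀ j t, t < m → x (m * j + t) = e (q t) + k (j + t % 2) := by
    intro j t ht
    have h1 : (m * j + t) / m = j := by
      rw [Nat.mul_add_div hm0, Nat.div_eq_of_lt ht, add_zero]
    have h2 : (m * j + t) % m = t := by rw [Nat.mul_add_mod, Nat.mod_eq_of_lt ht]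
    simp only [x, h1, h2]
    rw [← periodic_mod hqp (m * j + t), h2]
  have hlt : ∀ i, i % m < m := fun i => Nat.mod_lt _ hm0
  have hshift : ∀ i s, s ≤ 1 → k (i + (r - s) + s) = k i := by
    intro i s hs
    rw [show i + (r - s) + s = i + r by omega, hkp]
  refine ⟨x, fun i => ?_, fun y => ?_, fun y => ?_⟩
  · have := Nat.div_add_mod i m
    rw [hcard, ← this, show m * (i / m) + i % m + m * r = m * (i / m + r) + i % m by ring,
      hx _ _ (hlt i), hx _ _ (hlt i), add_right_comm, hkp]
  · obtain ⟨i, hi⟩ := hqs (φ y)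
    obtain ⟨κ, hκ⟩ := hker y _ rfl
    obtain ⟨j, rfl⟩ := hks κ
    refine ⟨m * (j + (r - i % m % 2)) + i % m, ?_⟩
    rw [hx _ _ (hlt i), hshift _ _ (by omega), periodic_mod hqp, hi]
    exact hκ.symm
  · obtain ⟨i, hi⟩ := hqt (φ y)
    simp only at hi
    obtain ⟨κ, hκ⟩ : ∃ κ : φ.ker, y = e (q i) + e (q (i + 1)) + κ :=
      ⟨⟨y - (e (q i) + e (q (i + 1))), by
        rw [AddMonoidHom.mem_ker, map_sub, map_add, he, he, hi, sub_self]⟩, by simp⟩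
    obtain ⟨j, hj⟩ := hkt κ
    simp only at hj
    refine ⟨m * j + i % m, ?_⟩
    simp only
    have hi1 : q ((i % m + 1) % m) = q (i + 1) := by
      rw [← periodic_mod hqp (i + 1)]; simp
    rw [hx _ _ (hlt i), hκ, ← hj, periodic_mod hqp]
    have hpar : i % m % 2 = 0 ∨ i % m % 2 = 1 := by omega
    rcases Nat.lt_or_ge (i % m + 1) m with h | h
    · rw [Nat.mod_eq_of_lt h] at hi1
      rw [add_assoc (m * j), hx _ _ h, hi1, AddSubgroup.coe_add]
      rcases hpar with h0 | h0
      · rw [show (i % m + 1) % 2 = 1 by omega, h0, add_zero]; abel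
      · rw [show (i % m + 1) % 2 = 0 by omega, h0, add_zero]; abel
    · have h' : i % m + 1 = m := by have := hlt i; omega
      -- As `m` is odd, lap `j` ends on the kernel term `k j`, and the next lap opens with `k (j +
      -- 1)`. The wrap-around step thus behaves like every other step.
      have h0 : i % m % 2 = 0 := by
        obtain ⟨s, hs⟩ := hodd; omega
      rw [h', Nat.mod_self] at hi1
      rw [show m * j + i % m + 1 = m * (j + 1) + 0 by rw [mul_add, mul_one, add_assoc, h']; rfl,
        hx _ _ hm0, hi1, AddSubgroup.coe_add, h0]
      simp only [add_zero, Nat.zero_mod]; abel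

theorem Harmonic.of_subsingleton {A : Type*} [AddCommGroup A] [Subsingleton A] : Harmonic A :=
  ⟨fun _ => 0, fun _ => rfl, fun _ => ⟨0, Subsingleton.elim _ _⟩, fun _ => ⟨0, Subsingleton.elim _ _⟩⟩

theorem Harmonic.zmultiples_of_odd {A : Type*} [AddCommGroup A] [Finite A] (x : A)
    (hx : Odd (Nat.card (AddSubgroup.zmultiples x))) :
    Harmonic (AddSubgroup.zmultiples x) := by
  set n := Nat.card (AddSubgroup.zmultiples x) with hn
  have hnx : n • x = 0 := by rw [hn, Nat.card_zmultiples]; exact addOrderOf_nsmul_eq_zero x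
  let g : AddSubgroup.zmultiples x := ⟨x, AddSubgroup.mem_zmultiples x⟩
  have hng : n • g = 0 := Subtype.ext (by simpa [g] using hnx)
  have hs : ∀ y : AddSubgroup.zmultiples x, ∃ i : ℕ, i • g = y := by
    rintro ⟨y, hy⟩
    obtain ⟨i, hi⟩ := (mem_multiples_iff_mem_zmultiples (x := x)).2 hy
    exact ⟨i, Subtype.ext (by simpa [g] using hi)⟩
  obtain ⟨s, hs'⟩ := hx
  refine ⟨fun i => i • g, fun i => ?_, hs, fun y => ?_⟩
  · simp only [← hn, add_smul, hng, add_zero]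
  · obtain ⟨i, rfl⟩ := hs y
    -- The solution of 2t + 1 = i modulo n = 2s + 1 is t = (i - 1)(s + 1); adding n avoids truncated
    -- subtraction.
    refine ⟨(i + n - 1) * (s + 1), ?_⟩
    simp only [← add_smul]
    have : (i + n - 1) * (s + 1) + ((i + n - 1) * (s + 1) + 1) = i + n * (i + n) := by
      obtain ⟨t, ht⟩ : ∃ t, i + n - 1 = t := ⟨_, rfl⟩
      have h2 : i + n = t + 1 := by omega
      have h3 : i = t - 2 * s := by omega
      have h4 : 2 * s ≤ t := by omega
      obtain ⟨w, rfl⟩ := Nat.exists_eq_add_of_le h4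
      rw [ht, h2, h3, hs', Nat.add_sub_cancel_left]; ring
    rw [this, add_smul, mul_comm, mul_smul, hng, smul_zero, add_zero]

theorem Harmonic.of_odd_card (A : Type*) [AddCommGroup A] [Finite A] (hA : Odd (Nat.card A)) :
    Harmonic A := by
  induction hn : Nat.card A using Nat.strong_induction_on generalizing A with
  | _ n ih =>
    rcases subsingleton_or_nontrivial A with h | h
    · exact Harmonic.of_subsingleton
    · obtain ⟨x, hx⟩ := exists_ne (0 : A)
      have hmul := AddSubgroup.card_eq_card_quotient_mul_card_addSubgroup (AddSubgroup.zmultiples x)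
      rw [hmul, Nat.odd_mul] at hA
      have hlt : Nat.card (A ⧸ AddSubgroup.zmultiples x) < n := by
        rw [← hn, hmul]
        refine lt_mul_of_one_lt_right Nat.card_pos ?_
        rw [AddSubgroup.one_lt_card_iff_ne_bot]
        simpa using hx
      have hker := QuotientAddGroup.ker_mk' (AddSubgroup.zmultiples x)
      refine Harmonic.of_ker_of_odd (QuotientAddGroup.mk' (AddSubgroup.zmultiples x))
        (QuotientAddGroup.mk'_surjective _) ?_ (ih _ hlt _ hA.1 rfl) hA.1
      rw [hker]
      exact Harmonic.zmultiples_of_odd x hA.2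

theorem Harmonic.of_ker_of_odd_card {A B : Type*} [AddCommGroup A] [AddCommGroup B] [Finite A]
    (φ : A →+ B) (hφ : Function.Surjective φ) (hK : Harmonic φ.ker) (hodd : Odd (Nat.card B)) :
    Harmonic A :=
  have : Finite B := Finite.of_surjective φ hφ
  Harmonic.of_ker_of_odd φ hφ hK (Harmonic.of_odd_card B hodd) hodd

/-! ### Consecutive entries of lists, as two-element infixes. -/

section ListAdjacency

variable {α β : Type*}

theorem not_pair_infix_nil (u v : α) : ¬ [u, v] <:+: ([] : List α) := by
  simp [List.infix_nil]

theorem pair_infix_cons {u v x : α} {l : List α} :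
    [u, v] <:+: x :: l ↔ (u = x ∧ l.head? = some v) ∨ [u, v] <:+: l := by
  rw [List.infix_cons_iff]
  refine or_congr_left ?_
  cases l with
  | nil => simp
  | cons y l => simp [List.cons_prefix_cons, eq_comm]

theorem pair_infix_append {u v : α} {l₁ l₂ : List α} :
    [u, v] <:+: l₁ ++ l₂ ↔ [u, v] <:+: l₁ ∨ [u, v] <:+: l₂ ∨
      (l₁.getLast? = some u ∧ l₂.head? = some v) := by
  induction l₁ with
  | nil => simp
  | cons x l ih =>
    rw [List.cons_append, pair_infix_cons, ih, pair_infix_cons]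
    cases l with
    | nil =>
      simp only [List.nil_append, List.head?_nil, reduceCtorEq, and_false, not_pair_infix_nil,
        List.getLast?_singleton, List.getLast?_nil, false_and, or_false, Option.some_inj, false_or, eq_comm (a := u)]
      exact or_comm
    | cons y l => simp [List.getLast?_cons_cons, or_assoc]

theorem pair_infix_reverse {u v : α} {l : List α} :
    [u, v] <:+: l.reverse ↔ [v, u] <:+: l := by
  rw [← List.reverse_infix]; simp

theorem pair_infix_map (f : α → β) {u v : α} {l : List α} (h : [u, v] <:+: l) :
    [f u, f v] <:+: l.map f := h.map f

/-- `v` follows `u` in `l`, read cyclically. -/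
def CyclicAdj (l : List α) (u v : α) : Prop :=
  [u, v] <:+: l ∨ (l.getLast? = some u ∧ l.head? = some v)

theorem cyclicAdj_append_comm {l₁ l₂ : List α} (h₁ : l₁ ≠ []) (h₂ : l₂ ≠ []) {u v : α} :
    CyclicAdj (l₁ ++ l₂) u v ↔ CyclicAdj (l₂ ++ l₁) u v := by
  rw [CyclicAdj, CyclicAdj, pair_infix_append, pair_infix_append, List.getLast?_append_of_ne_nil _ h₂,
    List.getLast?_append_of_ne_nil _ h₁, List.head?_append_of_ne_nil _ h₁,
    List.head?_append_of_ne_nil _ h₂]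
  tauto

theorem pair_infix_flatMap {ρ : Type*} {p : ρ → List α} {rs : List ρ} {r : ρ} (hr : r ∈ rs)
    {u v : α} (h : [u, v] <:+: p r) : [u, v] <:+: rs.flatMap p := by
  obtain ⟨s, t, rfl⟩ := List.append_of_mem hr
  rw [List.flatMap_append, List.flatMap_cons, pair_infix_append, pair_infix_append]
  exact Or.inr (Or.inl (Or.inl h))

theorem pair_infix_flatMap_of_pair {ρ : Type*} {p : ρ → List α} {rs : List ρ} {r r' : ρ}
    (hr : [r, r'] <:+: rs) {u v : α} (hu : (p r).getLast? = some u)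
    (hv : (p r').head? = some v) : [u, v] <:+: rs.flatMap p := by
  obtain ⟨s, t, rfl⟩ := hr
  have : [u, v] <:+: p r ++ p r' := pair_infix_append.2 (Or.inr (Or.inr ⟨hu, hv⟩))
  refine this.trans ⟨s.flatMap p, t.flatMap p, ?_⟩
  simp [List.flatMap_append]

theorem pair_infix_range' {s n r : ℕ} (h₁ : s ≤ r) (h₂ : r + 1 < s + n) :
    [r, r + 1] <:+: List.range' s n := by
  obtain ⟨i, rfl⟩ := Nat.exists_eq_add_of_le h₁
  obtain ⟨j, rfl⟩ : ∃ j, n = i + (2 + j) := ⟨n - i - 2, by omega⟩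
  rw [← List.range'_append_1, ← List.range'_append_1]
  exact ⟨List.range' s i, List.range' (s + i + 2) j, by simp [List.range'_succ]⟩

end ListAdjacency

/-! ### Harmonic cycles and switches. -/

/-- A list that enumerates a group in such a way that the sums of cyclically consecutive elements
run through the group as well. -/
structure IsHarmonicCycle {A : Type*} [AddCommGroup A] (l : List A) : Prop where
  length_eq : l.length = Nat.card A
  mem : ∀ x, x ∈ l
  sum : ∀ y, ∃ u v, CyclicAdj l u v ∧ u + v = y

/-- A harmonic cycle together with two of its steps `b → b'` and `c → c'`, which cut it into the
pieces `X` and `Y`, and a further step between `a` and `a'` inside `Y`, related by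
`b + c = a + a'` and `a + b' = c + c'`. -/
def HasSwitch (A : Type*) [AddCommGroup A] : Prop :=
  ∃ (X Y : List A) (a a' b b' c c' : A), IsHarmonicCycle (X ++ Y) ∧
    (X.head? = some b' ∧ X.getLast? = some c ∧ b' ≠ c) ∧
    (Y.head? = some c' ∧ Y.getLast? = some b) ∧
    ([a, a'] <:+: Y ∨ [a', a] <:+: Y) ∧
    (a ≠ b ∧ a ≠ c' ∧ a' ≠ b ∧ a' ≠ c') ∧
    b + c = a + a' ∧ a + b' = c + c'

theorem cyclicAdj_iff_getElem {α : Type*} {l : List α} {u v : α} (h : CyclicAdj l u v) :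
    ∃ (i : ℕ) (hi : i < l.length), l[i] = u ∧
      l[(i + 1) % l.length]'(Nat.mod_lt _ (by omega)) = v := by
  rcases h with ⟨s, t, rfl⟩ | ⟨h1, h2⟩
  · refine ⟨s.length, by simp, by simp, ?_⟩
    have : (s.length + 1) % (s ++ [u, v] ++ t).length = s.length + 1 := by
      apply Nat.mod_eq_of_lt; simp
    have key : (s ++ [u, v] ++ t)[s.length + 1]'(by simp) = v := by simp
    simp only [this, key]
  · have hne : l ≠ [] := by rintro rfl; simp at h1
    have hpos := List.length_pos_iff.2 hne
    refine ⟨l.length - 1, by omega, ?_, ?_⟩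
    · rw [List.getLast?_eq_some_getLast hne, Option.some_inj, List.getLast_eq_getElem] at h1
      exact h1
    · rw [List.head?_eq_some_head hne, Option.some_inj, List.head_eq_getElem] at h2
      rw [← h2]
      congr 1
      rw [Nat.sub_add_cancel hpos, Nat.mod_self]

theorem IsHarmonicCycle.harmonic {A : Type*} [AddCommGroup A] [Finite A] {l : List A}
    (h : IsHarmonicCycle l) : Harmonic A := by
  have hpos : 0 < l.length := by rw [h.length_eq]; exact Nat.card_pos
  refine ⟨fun i => l[i % l.length]'(Nat.mod_lt _ hpos), fun i => ?_, fun x => ?_, fun y => ?_⟩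
  · simp [← h.length_eq]
  · obtain ⟨i, hi, hx⟩ := List.getElem_of_mem (h.mem x)
    exact ⟨i, by simp [Nat.mod_eq_of_lt hi, hx]⟩
  · obtain ⟨u, v, huv, rfl⟩ := h.sum y
    obtain ⟨i, hi, rfl, rfl⟩ := cyclicAdj_iff_getElem huv
    exact ⟨i, by simp [Nat.mod_eq_of_lt hi]⟩

theorem HasSwitch.harmonic {A : Type*} [AddCommGroup A] [Finite A] (h : HasSwitch A) :
    Harmonic A := by
  obtain ⟨X, Y, -, -, -, -, -, -, h, -⟩ := h
  exact h.harmonic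

theorem IsHarmonicCycle.nodup {A : Type*} [AddCommGroup A] [Finite A] {l : List A}
    (h : IsHarmonicCycle l) : l.Nodup := by
  classical
  have := Fintype.ofFinite A
  rw [← Multiset.coe_nodup, ← Multiset.toFinset_card_eq_card_iff_nodup]
  have : (l : Multiset A).toFinset = Finset.univ := by ext x; simp [h.mem x]
  rw [this, Multiset.coe_card, h.length_eq, Finset.card_univ, Nat.card_eq_fintype_card]

theorem IsHarmonicCycle.append_comm {A : Type*} [AddCommGroup A] {l₁ l₂ : List A} (h₁ : l₁ ≠ [])
    (h₂ : l₂ ≠ []) (h : IsHarmonicCycle (l₁ ++ l₂)) : IsHarmonicCycle (l₂ ++ l₁) where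
  length_eq := by rw [← h.length_eq]; simp [add_comm]
  mem x := by have := h.mem x; simp only [List.mem_append] at this ⊢; tauto
  sum y := by
    obtain ⟨u, v, huv, hy⟩ := h.sum y
    exact ⟨u, v, (cyclicAdj_append_comm h₁ h₂).1 huv, hy⟩

theorem CyclicAdj.map {α γ : Type*} (f : α → γ) {l : List α} {u v : α} (h : CyclicAdj l u v) :
    CyclicAdj (l.map f) (f u) (f v) := by
  rcases h with h | ⟨h1, h2⟩
  · exact Or.inl (pair_infix_map f h)
  · exact Or.inr ⟨by simp [h1], by simp [h2]⟩

theorem IsHarmonicCycle.map {A B : Type*} [AddCommGroup A] [AddCommGroup B] (f : A ≃+ B)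
    {l : List A} (h : IsHarmonicCycle l) : IsHarmonicCycle (l.map f) where
  length_eq := by rw [List.length_map, h.length_eq, Nat.card_congr f.toEquiv]
  mem x := List.mem_map.2 ⟨f.symm x, h.mem _, f.apply_symm_apply x⟩
  sum y := by
    obtain ⟨u, v, huv, hy⟩ := h.sum (f.symm y)
    exact ⟨f u, f v, huv.map f, by rw [← map_add, hy, f.apply_symm_apply]⟩

theorem HasSwitch.of_addEquiv {A B : Type*} [AddCommGroup A] [AddCommGroup B] (f : A ≃+ B)
    (h : HasSwitch A) : HasSwitch B := by
  obtain ⟨X, Y, a, a', b, b', c, c', h, ⟨h1, h2, h3⟩, ⟨h4, h5⟩, h6, ⟨h7, h8, h9, h10⟩, h11, h12⟩ := h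
  refine ⟨X.map f, Y.map f, f a, f a', f b, f b', f c, f c', by simpa using h.map f,
    ⟨by simp [h1], by simp [h2], by simpa using h3⟩, ⟨by simp [h4], by simp [h5]⟩,
    h6.imp (pair_infix_map f) (pair_infix_map f), by simp [h7, h8, h9, h10], ?_, ?_⟩
  · rw [← map_add, h11, map_add]
  · rw [← map_add, h12, map_add]

/-! ### Colourings of paths by nonzero field elements. -/

theorem exists_ne_zero_of_four_le {F : Type*} [Field F] [Finite F] (hF : 4 ≤ Nat.card F) (s t : F) :
    ∃ x : F, x ≠ 0 ∧ x ≠ s ∧ x ≠ t := by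
  classical
  have := Fintype.ofFinite F
  by_contra! h
  have : (Finset.univ : Finset F) ⊆ {0, s, t} := by
    intro x _
    simp only [Finset.mem_insert, Finset.mem_singleton]
    by_cases h0 : x = 0
    · exact Or.inl h0
    · by_cases h1 : x = s
      · exact Or.inr (Or.inl h1)
      · exact Or.inr (Or.inr (h x h0 h1))
  have h1 := (Finset.card_le_card this).trans Finset.card_le_three
  rw [Finset.card_univ, ← Nat.card_eq_fintype_card] at h1
  omega

/-- Paths have proper colourings by nonzero field elements with prescribed end colours. -/
theorem exists_coloring {F : Type*} [Field F] [Finite F] (hF : 4 ≤ Nat.card F) (n : ℕ) (s t : F)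
    (hst : s ≠ t) : ∃ cs : List F, cs.length = n ∧ (∀ x ∈ cs, x ≠ 0) ∧
      (s :: (cs ++ [t])).IsChain (· ≠ ·) := by
  induction n generalizing s with
  | zero => exact ⟨[], rfl, by simp, by simpa using hst⟩
  | succ n ih =>
    -- Every intermediate colour also avoids the final colour `t`, so the path can close after any
    -- number of steps.
    obtain ⟨y, hy0, hys, hyt⟩ := exists_ne_zero_of_four_le hF s t
    obtain ⟨cs, hl, h0, hc⟩ := ih y hyt
    exact ⟨y :: cs, by simp [hl], by simpa using ⟨hy0, h0⟩,
      by rw [List.cons_append, List.isChain_cons_cons]; exact ⟨hys.symm, hc⟩⟩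

theorem exists_map_eq {α β : Type*} [Nonempty β] (l : List α) (hl : l.Nodup) (cs : List β)
    (h : l.length = cs.length) : ∃ g : α → β, l.map g = cs := by
  classical
  induction l generalizing cs with
  | nil => exact ⟨fun _ => Classical.arbitrary β, by simpa [eq_comm] using h⟩
  | cons x l ih =>
    cases cs with
    | nil => simp at h
    | cons c cs =>
      obtain ⟨g, hg⟩ := ih (List.nodup_cons.1 hl).2 cs (by simpa using h)
      refine ⟨Function.update g x c, ?_⟩
      rw [List.map_cons, Function.update_self, ← hg]
      congr 1
      refine List.map_congr_left fun y hy => Function.update_of_ne ?_ _ _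
      rintro rfl
      exact (List.nodup_cons.1 hl).1 hy

theorem ne_of_chain_map {α β : Type*} {g : α → β} {l : List α}
    (h : (l.map g).IsChain (· ≠ ·)) {u v : α} (huv : [u, v] <:+: l) : g u ≠ g v := by
  have := h.infix (pair_infix_map g huv)
  simpa using this

/-- The end colours are those that make the junctions of the lifted cycle supply the missing sums;
the ratio `ρ` across the step `d`, `d'` lets the lifted cycle have a switch again. -/
theorem exists_switch_coloring {B F : Type*} [Field F] [Finite F] (hF : 4 ≤ Nat.card F) {β ρ : F}
    (hβ0 : β ≠ 0) (hβ1 : β ≠ 1) (hβ2 : 1 + β ≠ 0) (hρ0 : ρ ≠ 0) (hρ1 : ρ ≠ 1)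
    {X₁ Y₁ Y₂ : List B} {b b' c c' d d' : B}
    (hnd : ((b' :: (X₁ ++ [c])) ++ (c' :: (Y₁ ++ ([d, d'] ++ (Y₂ ++ [b]))))).Nodup) :
    ∃ g : B → F, (∀ x ∈ (b' :: (X₁ ++ [c])) ++ (c' :: (Y₁ ++ ([d, d'] ++ (Y₂ ++ [b])))), g x ≠ 0) ∧
      (∀ u v, [u, v] <:+: b' :: (X₁ ++ [c]) → g u ≠ g v) ∧
      (∀ u v, [u, v] <:+: c' :: (Y₁ ++ ([d, d'] ++ (Y₂ ++ [b]))) → g u ≠ g v) ∧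
      g b' = β ∧ g c = 1 ∧ g c' = 1 + β ∧ g b = β ∧ g d' = ρ * g d := by
  -- With `γ` as the colour of `d`, these exclusions say that both parts of the second path, from 1
  -- + β to γ and from ργ to β, have distinct end colours.
  obtain ⟨γ, hγ0, hγ1, hγ2⟩ := exists_ne_zero_of_four_le hF (1 + β) (β / ρ)
  have hγ3 : ρ * γ ≠ β := by
    rintro rfl
    exact hγ2 (by field_simp)
  obtain ⟨C₁, h1l, h1n, h1c⟩ := exists_coloring hF X₁.length β 1 hβ1
  obtain ⟨C₂, h2l, h2n, h2c⟩ := exists_coloring hF Y₁.length (1 + β) γ hγ1.symm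
  obtain ⟨C₃, h3l, h3n, h3c⟩ := exists_coloring hF Y₂.length (ρ * γ) β hγ3
  obtain ⟨g, hg⟩ := exists_map_eq _ hnd
    ((β :: (C₁ ++ [1])) ++ ((1 + β) :: (C₂ ++ ([γ, ρ * γ] ++ (C₃ ++ [β])))))
    (by simp [h1l, h2l, h3l])
  have hg' := hg
  rw [List.map_append] at hg
  obtain ⟨hX, hY⟩ := List.append_inj hg (by simp [h1l])
  have hcX : (List.map g (b' :: (X₁ ++ [c]))).IsChain (· ≠ ·) := by rw [hX]; exact h1c
  have hcY : (List.map g (c' :: (Y₁ ++ ([d, d'] ++ (Y₂ ++ [b]))))).IsChain (· ≠ ·) := by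
    rw [hY]
    have hγρ : γ ≠ ρ * γ := by
      intro h
      apply hρ1
      have : (ρ - 1) * γ = 0 := by linear_combination -h
      rcases mul_eq_zero.1 this with h | h
      · exact sub_eq_zero.1 h
      · exact absurd h hγ0
    have e : (1 + β) :: (C₂ ++ ([γ, ρ * γ] ++ (C₃ ++ [β]))) =
        ((1 + β) :: (C₂ ++ [γ])) ++ ((ρ * γ) :: (C₃ ++ [β])) := by simp
    rw [e, List.isChain_append]
    refine ⟨h2c, h3c, ?_⟩
    intro x hx y hy
    rw [← List.cons_append, List.getLast?_append_of_ne_nil _ (by simp)] at hx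
    simp at hx hy
    subst hx; subst hy
    exact hγρ
  refine ⟨g, ?_, fun u v => ne_of_chain_map hcX, fun u v => ne_of_chain_map hcY, ?_⟩
  · intro x hx
    have : g x ∈ List.map g _ := List.mem_map_of_mem hx
    rw [hg'] at this
    simp only [List.mem_append, List.mem_cons, List.not_mem_nil, or_false] at this
    rcases this with (h | h | h) | h | h | (h | h) | h | h
    · rw [h]; exact hβ0
    · exact h1n _ h
    · rw [h]; exact one_ne_zero
    · rw [h]; exact hβ2
    · exact h2n _ h
    · rw [h]; exact hγ0
    · rw [h]; exact mul_ne_zero hρ0 hγ0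
    · exact h3n _ h
    · rw [h]; exact hβ0
  · simp only [List.map_cons, List.map_append, List.map_nil, List.cons.injEq] at hX hY
    obtain ⟨hb', hX⟩ := hX
    obtain ⟨hc', hY⟩ := hY
    obtain ⟨-, hX⟩ := List.append_inj hX (by simp [h1l])
    obtain ⟨-, hY⟩ := List.append_inj hY (by simp [h2l])
    simp only [List.cons_append, List.nil_append, List.cons.injEq, and_true] at hX hY
    obtain ⟨hd, hd', hY⟩ := hY
    obtain ⟨-, hY⟩ := List.append_inj hY (by simp [h3l])
    simp only [List.cons.injEq, and_true] at hY
    exact ⟨hb', hX, hc', hY, by rw [hd, hd']⟩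

/-! ### Lifting a switch through an elementary abelian 2-group. -/

/-- A cycle with the step `d → d'` removed, read as a path from `d'` to `d`. -/
theorem exists_cut_path {A B : Type*} (e : B → A) {W₁ W₂ : List B} {a a' d d' : B}
    (hd : W₁.getLast? = some d) (hd' : W₂.head? = some d')
    (h : (d = a ∧ d' = a') ∨ (d = a' ∧ d' = a)) :
    ∃ O : List A, O.length = (W₁ ++ W₂).length ∧ (∀ q ∈ W₁ ++ W₂, e q ∈ O) ∧
      O.head? = some (e a) ∧ O.getLast? = some (e a') ∧
      ∀ u v, CyclicAdj (W₁ ++ W₂) u v →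
        ((u = a ∧ v = a') ∨ (u = a' ∧ v = a)) ∨ [e u, e v] <:+: O ∨ [e v, e u] <:+: O := by
  have h1 : W₁ ≠ [] := by rintro rfl; simp at hd
  have h2 : W₂ ≠ [] := by rintro rfl; simp at hd'
  have hhead : (W₂ ++ W₁).head? = some d' := by rw [List.head?_append_of_ne_nil _ h2, hd']
  have hlast : (W₂ ++ W₁).getLast? = some d := by rw [List.getLast?_append_of_ne_nil _ h1, hd]
  have hadj : ∀ u v, CyclicAdj (W₁ ++ W₂) u v →
      (u = d ∧ v = d') ∨ [e u, e v] <:+: (W₂ ++ W₁).map e := by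
    intro u v huv
    rcases (cyclicAdj_append_comm h1 h2).1 huv with h | ⟨h3, h4⟩
    · exact Or.inr (pair_infix_map e h)
    · rw [hhead] at h4; rw [hlast] at h3
      exact Or.inl ⟨(Option.some_inj.1 h3).symm, (Option.some_inj.1 h4).symm⟩
  have hmem : ∀ q ∈ W₁ ++ W₂, e q ∈ (W₂ ++ W₁).map e := by
    intro q hq
    refine List.mem_map_of_mem ?_
    simp only [List.mem_append] at hq ⊢; tauto
  rcases h with ⟨rfl, rfl⟩ | ⟨rfl, rfl⟩
  · refine ⟨((W₂ ++ W₁).map e).reverse, by simp, fun q hq => ?_, ?_, ?_, fun u v huv => ?_⟩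
    · exact List.mem_reverse.2 (hmem q hq)
    · rw [List.head?_reverse, List.getLast?_map, hlast]; rfl
    · rw [List.getLast?_reverse, List.head?_map, hhead]; rfl
    · rw [pair_infix_reverse, pair_infix_reverse]
      rcases hadj u v huv with h | h
      · exact Or.inl (Or.inl h)
      · exact Or.inr (Or.inr h)
  · refine ⟨(W₂ ++ W₁).map e, by simp [add_comm], hmem, ?_, ?_, fun u v huv => ?_⟩
    · rw [List.head?_map, hhead]; rfl
    · rw [List.getLast?_map, hlast]; rfl
    · rcases hadj u v huv with h | h
      · exact Or.inl (Or.inr h)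
      · exact Or.inr (Or.inl h)

/-- Layers 1, …, N - 1 are traversed in full; then layer 0 is traversed with `X` reversed and the
zero layer `O` inserted before `Y`. Steps inside `X` or `Y` occur in all N layers and give all
nonzero translates of their sums. `O` gives the zero translates, except for its removed step. Four
junctions repair the rest. From `b` in layer N - 1 to `c` in layer 0 the kernel part is 1 + 1 = 0,
which restores the sum of `a` and `a'`. The step from `c` to `c'` has kernel part β^(r+1) and misses
only β, as r = 0 is absent; the junction from `b'` to `e a` supplies it. The step from `b` to `b'`
climbs from layer r to r + 1, the case r = 0 being the closing step of the cycle. It misses only 1 +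
β, supplied by the junction from `e a'` to `c'`. -/
theorem isHarmonicCycle_lift {A B F : Type*} [AddCommGroup A] [AddCommGroup B] [Field F]
    (φ : A →+ B) (ι : F →+ A) (hι : ∀ x, φ x = 0 → ∃ κ, ι κ = x) (e : B → A)
    (he : ∀ q, φ (e q) = q) {N : ℕ} (hN : 2 ≤ N) (hcard : Nat.card A = (N + 1) * Nat.card B)
    {β : F} (hβ0 : β ≠ 0) (hβ2 : 1 + β ≠ 0) (hβN : β ^ N = 1)
    (hgen : ∀ x : F, x ≠ 0 → ∃ r < N, x = β ^ r) (h2 : (1 : F) + 1 = 0)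
    {X Y : List B} {a a' b b' c c' : B} (hW : IsHarmonicCycle (X ++ Y))
    (hXh : X.head? = some b') (hXl : X.getLast? = some c)
    (hYh : Y.head? = some c') (hYl : Y.getLast? = some b)
    (g : B → F) (hg0 : ∀ q, g q ≠ 0) (hgX : ∀ u v, [u, v] <:+: X → g u ≠ g v)
    (hgY : ∀ u v, [u, v] <:+: Y → g u ≠ g v)
    (hgb' : g b' = β) (hgc : g c = 1) (hgc' : g c' = 1 + β) (hgb : g b = β)
    (h1 : e b + e c = e a + e a') (h3 : e a + e b' = e c + e c')
    (O : List A) (hOlen : O.length = (X ++ Y).length) (hOmem : ∀ q ∈ X ++ Y, e q ∈ O)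
    (hOh : O.head? = some (e a)) (hOl : O.getLast? = some (e a'))
    (hO : ∀ u v, CyclicAdj (X ++ Y) u v →
        ((u = a ∧ v = a') ∨ (u = a' ∧ v = a)) ∨ [e u, e v] <:+: O ∨ [e v, e u] <:+: O)
    (lift : ℕ → B → A) (hlift : ∀ r q, lift r q = e q + ι (β ^ r * g q)) :
    IsHarmonicCycle ((List.range' 1 (N - 1)).flatMap
        (fun r => X.map (lift r) ++ Y.map (lift r)) ++
      ((X.map (lift 0)).reverse ++ (O ++ Y.map (lift 0)))) := by
  have hXne : X ≠ [] := by rintro rfl; simp at hXh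
  have hYne : Y ≠ [] := by rintro rfl; simp at hYh
  have hOne : O ≠ [] := by rintro rfl; simp at hOh
  have hXmne : ∀ r, X.map (lift r) ≠ [] := by simpa using hXne
  have hYmne : ∀ r, Y.map (lift r) ≠ [] := by simpa using hYne
  set p : ℕ → List A := fun r => X.map (lift r) ++ Y.map (lift r) with hp
  have hph : ∀ r, (p r).head? = some (lift r b') := by
    intro r
    simp only [hp]
    rw [List.head?_append_of_ne_nil _ (hXmne r), List.head?_map, hXh]; rfl
  have hpl : ∀ r, (p r).getLast? = some (lift r b) := by
    intro r
    simp only [hp]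
    rw [List.getLast?_append_of_ne_nil _ (hYmne r), List.getLast?_map, hYl]; rfl
  set M := (List.range' 1 (N - 1)).flatMap p with hM
  have hrange : ∀ r, r ∈ List.range' 1 (N - 1) ↔ 1 ≤ r ∧ r < N := by
    intro r; rw [List.mem_range'_1]; omega
  have hMh : M.head? = some (lift 1 b') := by
    obtain ⟨n, hn⟩ : ∃ n, N - 1 = n + 1 := ⟨N - 2, by omega⟩
    have hne : p 1 ≠ [] := by intro h; have := hph 1; rw [h] at this; simp at this
    rw [hM, hn, List.range'_succ, List.flatMap_cons, List.head?_append_of_ne_nil _ hne, hph]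
  have hMl : M.getLast? = some (lift (N - 1) b) := by
    obtain ⟨n, hn⟩ : ∃ n, N - 1 = n + 1 := ⟨N - 2, by omega⟩
    have hne : p (1 + n) ≠ [] := by
      intro h; have := hph (1 + n); rw [h] at this; simp at this
    rw [hM, hn, List.range'_1_concat, List.flatMap_append, List.flatMap_singleton,
      List.getLast?_append_of_ne_nil _ hne, hpl, Nat.add_comm 1 n]
  have hMne : M ≠ [] := by intro h; rw [h] at hMh; simp at hMh
  set L := M ++ ((X.map (lift 0)).reverse ++ (O ++ Y.map (lift 0))) with hL
  have inM : ∀ {U V}, [U, V] <:+: M → CyclicAdj L U V := fun h =>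
    Or.inl (pair_infix_append.2 (Or.inl h))
  have inR : ∀ {U V}, [U, V] <:+: (X.map (lift 0)).reverse → CyclicAdj L U V := fun h =>
    Or.inl (pair_infix_append.2 (Or.inr (Or.inl (pair_infix_append.2 (Or.inl h)))))
  have inO : ∀ {U V}, [U, V] <:+: O → CyclicAdj L U V := fun h =>
    Or.inl (pair_infix_append.2 (Or.inr (Or.inl (pair_infix_append.2 (Or.inr (Or.inl
      (pair_infix_append.2 (Or.inl h))))))))
  have inY : ∀ {U V}, [U, V] <:+: Y.map (lift 0) → CyclicAdj L U V := fun h =>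
    Or.inl (pair_infix_append.2 (Or.inr (Or.inl (pair_infix_append.2 (Or.inr (Or.inl
      (pair_infix_append.2 (Or.inr (Or.inl h)))))))))
  have join₁ : CyclicAdj L (lift (N - 1) b) (lift 0 c) := by
    refine Or.inl (pair_infix_append.2 (Or.inr (Or.inr ⟨hMl, ?_⟩)))
    rw [List.head?_append_of_ne_nil _ (by simpa using hXne), List.head?_reverse,
      List.getLast?_map, hXl]; rfl
  have join₂ : CyclicAdj L (lift 0 b') (e a) := by
    refine Or.inl (pair_infix_append.2 (Or.inr (Or.inl (pair_infix_append.2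
      (Or.inr (Or.inr ⟨?_, ?_⟩))))))
    · rw [List.getLast?_reverse, List.head?_map, hXh]; rfl
    · rw [List.head?_append_of_ne_nil _ hOne, hOh]
  have join₃ : CyclicAdj L (e a') (lift 0 c') := by
    refine Or.inl (pair_infix_append.2 (Or.inr (Or.inl (pair_infix_append.2
      (Or.inr (Or.inl (pair_infix_append.2 (Or.inr (Or.inr ⟨hOl, ?_⟩)))))))))
    rw [List.head?_map, hYh]; rfl
  have join₀ : CyclicAdj L (lift 0 b) (lift 1 b') := by
    refine Or.inr ⟨?_, ?_⟩
    · rw [hL, List.getLast?_append_of_ne_nil _ (by simp [hXne]),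
        List.getLast?_append_of_ne_nil _ (by simp [hYne]),
        List.getLast?_append_of_ne_nil _ (hYmne 0), List.getLast?_map, hYl]; rfl
    · rw [hL, List.head?_append_of_ne_nil _ hMne, hMh]
  have stepX : ∀ u v, [u, v] <:+: X → ∀ r < N,
      CyclicAdj L (lift r u) (lift r v) ∨ CyclicAdj L (lift r v) (lift r u) := by
    intro u v huv r hr
    rcases Nat.eq_zero_or_pos r with rfl | hr0
    · exact Or.inr (inR (pair_infix_reverse.2 (pair_infix_map _ huv)))
    · exact Or.inl (inM (pair_infix_flatMap ((hrange r).2 ⟨hr0, hr⟩)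
        (pair_infix_append.2 (Or.inl (pair_infix_map _ huv)))))
  have stepY : ∀ u v, [u, v] <:+: Y → ∀ r < N,
      CyclicAdj L (lift r u) (lift r v) ∨ CyclicAdj L (lift r v) (lift r u) := by
    intro u v huv r hr
    rcases Nat.eq_zero_or_pos r with rfl | hr0
    · exact Or.inl (inY (pair_infix_map _ huv))
    · exact Or.inl (inM (pair_infix_flatMap ((hrange r).2 ⟨hr0, hr⟩)
        (pair_infix_append.2 (Or.inr (Or.inl (pair_infix_map _ huv))))))
  have stepc : ∀ r, 1 ≤ r → r < N → CyclicAdj L (lift r c) (lift r c') := by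
    intro r hr0 hr
    refine inM (pair_infix_flatMap ((hrange r).2 ⟨hr0, hr⟩)
        (pair_infix_append.2 (Or.inr (Or.inr ⟨?_, ?_⟩))))
    · rw [List.getLast?_map, hXl]; rfl
    · rw [List.head?_map, hYh]; rfl
  have stepb : ∀ r, r + 1 < N → CyclicAdj L (lift r b) (lift (r + 1) b') := by
    intro r hr
    rcases Nat.eq_zero_or_pos r with rfl | hr0
    · exact join₀
    · exact inM (pair_infix_flatMap_of_pair (pair_infix_range' hr0 (by omega)) (hpl r) (hph (r + 1)))
  have hker : ∀ y z, φ y = φ z → ∃ κ, y = z + ι κ := by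
    intro y z hyz
    obtain ⟨κ, hκ⟩ := hι (y - z) (by rw [map_sub, hyz, sub_self])
    exact ⟨κ, by rw [hκ]; abel⟩
  refine ⟨?_, fun x => ?_, fun y => ?_⟩
  · have hsum : ∀ rs : List ℕ, (rs.flatMap p).length = rs.length * (X ++ Y).length := by
      intro rs
      induction rs with
      | nil => simp
      | cons r rs ih =>
        rw [List.flatMap_cons, List.length_append, ih, List.length_cons, hp]
        simp only [List.length_append, List.length_map]; ring
    have hlen : L.length = (N - 1) * (X ++ Y).length + (X ++ Y).length + (X ++ Y).length := by
      rw [hL, List.length_append, hM, hsum, List.length_range']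
      simp only [List.length_append, List.length_reverse, List.length_map, hOlen]; ring
    obtain ⟨n, rfl⟩ : ∃ n, N = n + 1 := ⟨N - 1, by omega⟩
    rw [hlen, hcard, ← hW.length_eq, Nat.add_sub_cancel]; ring
  · obtain ⟨κ, hκ⟩ := hker x (e (φ x)) (he _).symm
    have hmem := hW.mem (φ x)
    rcases eq_or_ne κ 0 with rfl | hκ0
    · rw [map_zero, add_zero] at hκ
      rw [hκ]
      simp [hL, hOmem _ hmem]
    · obtain ⟨r, hr, hκr⟩ := hgen (κ / g (φ x)) (div_ne_zero hκ0 (hg0 _))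
      have hx : x = lift r (φ x) := by
        rw [hlift, ← hκr, div_mul_cancel₀ _ (hg0 _)]; exact hκ
      rw [hx]
      have hmem' : lift r (φ x) ∈ X.map (lift r) ∨ lift r (φ x) ∈ Y.map (lift r) :=
        (List.mem_append.1 hmem).imp List.mem_map_of_mem List.mem_map_of_mem
      rcases Nat.eq_zero_or_pos r with rfl | hr0
      · rw [hL]; simp only [List.mem_append, List.mem_reverse]; tauto
      · refine List.mem_append.2 (Or.inl (List.mem_flatMap.2 ⟨r, (hrange r).2 ⟨hr0, hr⟩, ?_⟩))
        exact List.mem_append.2 hmem'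
  · suffices h : ∃ U V, (CyclicAdj L U V ∨ CyclicAdj L V U) ∧ U + V = y by
      obtain ⟨U, V, h | h, rfl⟩ := h
      · exact ⟨U, V, h, rfl⟩
      · exact ⟨V, U, h, add_comm _ _⟩
    obtain ⟨u, v, huv, hy⟩ := hW.sum (φ y)
    obtain ⟨κ, hκ⟩ := hker y (e u + e v) (by rw [map_add, he, he, hy])
    have hchar : ∀ x : F, x + x = 0 := fun x => by linear_combination x * h2
    have sum_lift : ∀ r s u v, lift r u + lift s v =
        e u + e v + ι (β ^ r * g u + β ^ s * g v) := by
      intro r s u v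
      rw [hlift, hlift, map_add]; abel
    rcases eq_or_ne κ 0 with rfl | hκ0
    · rw [map_zero, add_zero] at hκ
      rcases hO u v huv with h | h | h
      · refine ⟨_, _, Or.inl join₁, ?_⟩
        have : β ^ (N - 1) * β + β ^ 0 * 1 = 0 := by
          rw [← pow_succ, Nat.sub_add_cancel (by omega), hβN, pow_zero, one_mul]; exact h2
        rw [sum_lift, hgb, hgc, this, map_zero, add_zero, h1, hκ]
        rcases h with ⟨rfl, rfl⟩ | ⟨rfl, rfl⟩
        · rfl
        · exact add_comm _ _
      · exact ⟨_, _, Or.inl (inO h), hκ.symm⟩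
      · exact ⟨_, _, Or.inr (inO h), hκ.symm⟩
    · have main : (∀ r < N, CyclicAdj L (lift r u) (lift r v) ∨ CyclicAdj L (lift r v) (lift r u)) →
          g u ≠ g v → ∃ U V, (CyclicAdj L U V ∨ CyclicAdj L V U) ∧ U + V = y := by
        intro hadj hne
        have hne' : g u + g v ≠ 0 := by
          intro h
          exact hne (by linear_combination h - hchar (g v))
        obtain ⟨r, hr, hκr⟩ := hgen (κ / (g u + g v)) (div_ne_zero hκ0 hne')
        refine ⟨_, _, hadj r hr, ?_⟩
        rw [sum_lift, hκ, ← hκr]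
        congr 2
        field_simp
      rcases huv with huv | ⟨h4, h5⟩
      · rcases pair_infix_append.1 huv with h | h | ⟨h4, h5⟩
        · exact main (stepX u v h) (hgX u v h)
        · exact main (stepY u v h) (hgY u v h)
        · rw [hXl, Option.some_inj] at h4
          rw [hYh, Option.some_inj] at h5
          subst h4; subst h5
          obtain ⟨r, hr, hκr⟩ := hgen (κ / β) (div_ne_zero hκ0 hβ0)
          rw [div_eq_iff hβ0] at hκr
          rcases Nat.eq_zero_or_pos r with rfl | hr0
          · refine ⟨_, _, Or.inl join₂, ?_⟩
            rw [hlift, hκ, hκr, ← h3, hgb']; abel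
          · refine ⟨_, _, Or.inl (stepc r hr0 hr), ?_⟩
            rw [sum_lift, hκ, hκr, hgc, hgc']
            congr 2
            linear_combination hchar (β ^ r)
      · rw [List.getLast?_append_of_ne_nil _ hYne, hYl, Option.some_inj] at h4
        rw [List.head?_append_of_ne_nil _ hXne, hXh, Option.some_inj] at h5
        subst h4; subst h5
        have hββ : β * (1 + β) ≠ 0 := mul_ne_zero hβ0 hβ2
        obtain ⟨r, hr, hκr⟩ := hgen (κ / (β * (1 + β))) (div_ne_zero hκ0 hββ)
        rw [div_eq_iff hββ] at hκr
        rcases Nat.lt_or_ge (r + 1) N with hr1 | hr1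
        · refine ⟨_, _, Or.inl (stepb r hr1), ?_⟩
          rw [sum_lift, hκ, hκr, hgb, hgb']
          congr 2
          ring
        · obtain rfl : N = r + 1 := by omega
          have hκ' : κ = 1 + β := by
            rw [hκr, ← mul_assoc, ← pow_succ, hβN, one_mul]
          refine ⟨_, _, Or.inl join₃, ?_⟩
          have h6 : e a' + e c' = e b + e b' := by
            have : e a' + e c' = (e a + e a') + (e c + e c') - e a - e c := by abel
            rw [this, ← h1, ← h3]; abel
          rw [hlift, hκ, hκ', ← add_assoc, h6, hgc', pow_zero, one_mul]

theorem exists_eq_cons_append {α : Type*} {l : List α} {x y : α} (hx : l.head? = some x)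
    (hy : l.getLast? = some y) (h : x ≠ y) : ∃ m, l = x :: (m ++ [y]) := by
  cases l with
  | nil => simp at hx
  | cons z l =>
    obtain rfl : z = x := by simpa using hx
    rcases List.eq_nil_or_concat l with rfl | ⟨m, w, rfl⟩
    · simp at hy; exact absurd hy h
    · refine ⟨m, ?_⟩
      rw [List.concat_eq_append, ← List.cons_append, List.getLast?_concat, Option.some_inj] at hy
      rw [hy, List.concat_eq_append]

theorem exists_eq_of_pair_infix {α : Type*} {l : List α} {x y d d' : α} (hx : l.head? = some x)
    (hy : l.getLast? = some y) (hd : [d, d'] <:+: l) (h1 : d ≠ x) (h2 : d' ≠ y) :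
    ∃ m₁ m₂, l = x :: (m₁ ++ ([d, d'] ++ (m₂ ++ [y]))) := by
  obtain ⟨s, t, rfl⟩ := hd
  cases s with
  | nil => simp at hx; exact absurd hx h1
  | cons z s =>
    obtain rfl : z = x := by simpa using hx
    rcases List.eq_nil_or_concat t with rfl | ⟨m, w, rfl⟩
    · rw [List.append_nil, List.getLast?_append_of_ne_nil _ (by simp)] at hy
      simp at hy; exact absurd hy h2
    · rw [List.concat_eq_append, ← List.append_assoc, List.getLast?_concat, Option.some_inj] at hy
      exact ⟨s, m, by simp [hy]⟩

/-- Sections may be chosen to lift the two relations of a switch. -/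
theorem exists_switch_section {A B : Type*} [AddCommGroup A] [AddCommGroup B] (φ : A →+ B)
    (hφ : Function.Surjective φ) {a a' b b' c c' : B} (h1 : b + c = a + a') (h2 : a + b' = c + c')
    (hba : b ≠ a) (hba' : b ≠ a') (hbc : b ≠ c) (hca : c' ≠ a) (hca' : c' ≠ a') (hcb : c' ≠ b)
    (hcb' : c' ≠ b') (hcc : c' ≠ c) :
    ∃ e : B → A, (∀ q, φ (e q) = q) ∧ e b + e c = e a + e a' ∧ e a + e b' = e c + e c' := by
  classical
  obtain ⟨e₀, he₀⟩ := hφ.hasRightInverse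
  -- The relations are solved in turn for the values at `b` and `c'`; the distinctness hypotheses
  -- keep the first one intact under the second update.
  let e₁ := Function.update e₀ b (e₀ a + e₀ a' - e₀ c)
  have he₁ : ∀ q, φ (e₁ q) = q := by
    intro q
    by_cases hq : q = b
    · subst hq
      simp only [e₁, Function.update_self, map_sub, map_add, he₀ _, ← h1, add_sub_cancel_right]
    · simp only [e₁, Function.update_of_ne hq, he₀ _]
  refine ⟨Function.update e₁ c' (e₁ a + e₁ b' - e₁ c), fun q => ?_, ?_, ?_⟩
  · by_cases hq : q = c'
    · subst hq
      simp only [Function.update_self, map_sub, map_add, he₁, h2, add_sub_cancel_left]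
    · rw [Function.update_of_ne hq, he₁]
  · rw [Function.update_of_ne hcb.symm, Function.update_of_ne hcc.symm,
      Function.update_of_ne hca.symm, Function.update_of_ne hca'.symm]
    simp [e₁, Function.update_of_ne hba.symm, Function.update_of_ne hba'.symm,
      Function.update_of_ne hbc.symm]
  · rw [Function.update_of_ne hcc.symm, Function.update_of_ne hca.symm,
      Function.update_of_ne hcb'.symm, Function.update_self]
    abel

/-- The new switch cuts the lifted cycle between `b` in layer 0 and `b'` in layer 1, and between `c`
and `c'` in layer 2. Its inner step is the copy of `a`, `a'` in one suitable layer `r`. -/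
theorem HasSwitch.lift {A B F : Type*} [AddCommGroup A] [AddCommGroup B] [Field F] [Finite F]
    [Finite B] (φ : A →+ B) (hφ : Function.Surjective φ) (ι : F →+ A) (hφι : ∀ κ, φ (ι κ) = 0)
    (hι : ∀ x, φ x = 0 → ∃ κ, ι κ = x) {N : ℕ} (hN : 3 ≤ N) (hF : Nat.card F = N + 1)
    (hcard : Nat.card A = (N + 1) * Nat.card B) {β : F} (hβ0 : β ≠ 0) (hβ1 : β ≠ 1)
    (hβN : β ^ N = 1) (hgen : ∀ x : F, x ≠ 0 → ∃ r < N, x = β ^ r) (h2 : (1 : F) + 1 = 0)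
    (hB : HasSwitch B) : HasSwitch A := by
  obtain ⟨X, Y, a, a', b, b', c, c', hW, ⟨hXh, hXl, hbc'⟩, ⟨hYh, hYl⟩, hgap,
    ⟨hab, hac', ha'b, ha'c'⟩, heq₁, heq₂⟩ := hB
  obtain ⟨d, d', hd, hdd⟩ : ∃ d d', [d, d'] <:+: Y ∧ ((d = a ∧ d' = a') ∨ (d = a' ∧ d' = a)) := by
    rcases hgap with h | h
    · exact ⟨_, _, h, Or.inl ⟨rfl, rfl⟩⟩
    · exact ⟨_, _, h, Or.inr ⟨rfl, rfl⟩⟩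
  have hdc' : d ≠ c' := by rcases hdd with ⟨rfl, -⟩ | ⟨rfl, -⟩ <;> assumption
  have hd'b : d' ≠ b := by rcases hdd with ⟨-, rfl⟩ | ⟨-, rfl⟩ <;> assumption
  have hnd := hW.nodup
  have hbX : b' ∈ X := List.mem_of_mem_head? hXh
  have hcX : c ∈ X := List.mem_of_mem_getLast? hXl
  have hc'Y : c' ∈ Y := List.mem_of_mem_head? hYh
  have hbY : b ∈ Y := List.mem_of_mem_getLast? hYl
  have hdY : d ∈ Y := hd.subset (by simp)
  have hd'Y : d' ∈ Y := hd.subset (by simp)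
  have haY : a ∈ Y := by rcases hdd with ⟨h, -⟩ | ⟨-, h⟩ <;> rw [← h] <;> assumption
  have ha'Y : a' ∈ Y := by rcases hdd with ⟨-, h⟩ | ⟨h, -⟩ <;> rw [← h] <;> assumption
  have hXY : ∀ x ∈ X, ∀ y ∈ Y, x ≠ y := fun x hx y hy h =>
    (List.nodup_append.1 hnd).2.2 x hx y hy h
  obtain ⟨X₁, rfl⟩ := exists_eq_cons_append hXh hXl hbc'
  obtain ⟨Y₁, Y₂, hYeq⟩ := exists_eq_of_pair_infix hYh hYl hd hdc' hd'b
  have hc'b : c' ≠ b := by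
    have := (List.nodup_append.1 hnd).2.1
    rw [hYeq, List.nodup_cons] at this
    rintro rfl
    exact this.1 (by simp)
  obtain ⟨e, he, he₁, he₂⟩ := exists_switch_section φ hφ heq₁ heq₂ hab.symm ha'b.symm
    (hXY c hcX b hbY).symm hac'.symm ha'c'.symm hc'b (hXY _ hbX _ hc'Y).symm (hXY _ hcX _ hc'Y).symm
  have hβ2 : 1 + β ≠ 0 := by
    intro h
    exact hβ1 (by linear_combination h - h2)
  -- The relations of the new switch force g(a') / g(a) = (1 + β) / β; `ρ` is this ratio or its
  -- inverse, according to the direction of the step.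
  obtain ⟨ρ, hρ0, hρ1, hρ⟩ : ∃ ρ : F, ρ ≠ 0 ∧ ρ ≠ 1 ∧
      ∀ g : B → F, g d' = ρ * g d → β * g a' = (1 + β) * g a := by
    rcases hdd with ⟨rfl, rfl⟩ | ⟨rfl, rfl⟩
    · refine ⟨(1 + β) / β, div_ne_zero hβ2 hβ0, fun h => ?_, fun g hg => ?_⟩
      · rw [div_eq_one_iff_eq hβ0] at h
        exact one_ne_zero (α := F) (by linear_combination h)
      · rw [hg]; field_simp
    · refine ⟨β / (1 + β), div_ne_zero hβ0 hβ2, fun h => ?_, fun g hg => ?_⟩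
      · rw [div_eq_one_iff_eq hβ2] at h
        exact one_ne_zero (α := F) (by linear_combination -h)
      · rw [hg]; field_simp
  obtain ⟨g, hg0, hgX, hgY, hgb', hgc, hgc', hgb, hgd⟩ := exists_switch_coloring (F := F)
    (by omega) hβ0 hβ1 hβ2 hρ0 hρ1 (hYeq ▸ hnd)
  rw [← hYeq] at hg0 hgY
  have hga := hρ g hgd
  obtain ⟨O, hOlen, hOmem, hOh, hOl, hO⟩ := exists_cut_path e (a := a) (a' := a')
    (W₁ := (b' :: (X₁ ++ [c])) ++ (c' :: (Y₁ ++ [d]))) (W₂ := d' :: (Y₂ ++ [b])) (d := d) (d' := d')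
    (by rw [List.getLast?_append_of_ne_nil _ (by simp), ← List.cons_append, List.getLast?_concat])
    rfl hdd
  have hWeq : ((b' :: (X₁ ++ [c])) ++ (c' :: (Y₁ ++ [d]))) ++ (d' :: (Y₂ ++ [b])) =
      (b' :: (X₁ ++ [c])) ++ Y := by rw [hYeq]; simp
  rw [hWeq] at hOlen hOmem hO
  let lift : ℕ → B → A := fun r q => e q + ι (β ^ r * g q)
  have hlift : ∀ r q, lift r q = e q + ι (β ^ r * g q) := fun _ _ => rfl
  have hφl : ∀ r q, φ (lift r q) = q := by
    intro r q; rw [hlift, map_add, he, hφι, add_zero]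
  set X := b' :: (X₁ ++ [c]) with hX
  have hcyc := isHarmonicCycle_lift φ ι hι e he (by omega) hcard hβ0 hβ2 hβN hgen h2 hW hXh hXl hYh
    hYl g (fun q => hg0 q (hW.mem q)) hgX hgY hgb' hgc hgc' hgb he₁ he₂ O hOlen hOmem hOh hOl hO
    lift hlift
  have hXne : X ≠ [] := by simp [hX]
  have hYne : Y ≠ [] := by rw [hYeq]; simp
  have hXm : ∀ r, X.map (lift r) ≠ [] := by simp [hX]
  have hYm : ∀ r, Y.map (lift r) ≠ [] := by simpa using hYne
  set p : ℕ → List A := fun r => X.map (lift r) ++ Y.map (lift r) with hp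
  -- The piece between the two cuts: layer 1 and the `X`-part of layer 2. Layer 2 exists because N ≥
  -- 3.
  let X' := X.map (lift 1) ++ (Y.map (lift 1) ++ X.map (lift 2))
  let T := (X.map (lift 0)).reverse ++ (O ++ Y.map (lift 0))
  let Y' := Y.map (lift 2) ++ ((List.range' 3 (N - 3)).flatMap p ++ T)
  have hsplit : (List.range' 1 (N - 1)).flatMap p ++ T = X' ++ Y' := by
    obtain ⟨n, rfl⟩ : ∃ n, N = n + 3 := ⟨N - 3, by omega⟩
    rw [show n + 3 - 1 = n + 1 + 1 by omega, List.range'_succ, List.range'_succ]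
    simp [X', Y', hp]
  rw [hsplit] at hcyc
  have hTne : T ≠ [] := by simp [T, hXne]
  have hX'ne : X' ≠ [] := by simp [X', hXne]
  have hY'ne : Y' ≠ [] := by simp [Y', hYne]
  have hX'h : X'.head? = some (lift 1 b') := by
    rw [List.head?_append_of_ne_nil _ (hXm 1), List.head?_map, hXh]; rfl
  have hX'l : X'.getLast? = some (lift 2 c) := by
    rw [List.getLast?_append_of_ne_nil _ (by simp [hXne]),
      List.getLast?_append_of_ne_nil _ (hXm 2), List.getLast?_map, hXl]; rfl
  have hY'h : Y'.head? = some (lift 2 c') := by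
    rw [List.head?_append_of_ne_nil _ (hYm 2), List.head?_map, hYh]; rfl
  have hY'l : Y'.getLast? = some (lift 0 b) := by
    rw [List.getLast?_append_of_ne_nil _ (by simp [hTne]),
      List.getLast?_append_of_ne_nil _ hTne, List.getLast?_append_of_ne_nil _ (by simp [hYne]),
      List.getLast?_append_of_ne_nil _ (hYm 0), List.getLast?_map, hYl]; rfl
  -- The kernel part of the second relation reads β^r g(a) + β² = β³, which determines the layer.
  obtain ⟨r, hr, hβr⟩ := hgen (β ^ 2 * (1 + β) / g a)
    (div_ne_zero (mul_ne_zero (pow_ne_zero _ hβ0) hβ2) (hg0 a (hW.mem a)))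
  have hr₁ : β ^ r * g a = β ^ 2 * (1 + β) := by
    rw [← hβr, div_mul_cancel₀ _ (hg0 a (hW.mem a))]
  have hr₂ : β ^ r * g a' = β * (1 + β) ^ 2 := by
    apply mul_left_cancel₀ hβ0
    linear_combination β ^ r * hga + (1 + β) * hr₁
  have heq₁' : lift 0 b + lift 2 c = lift r a + lift r a' := by
    have : lift 0 b + lift 2 c = (e b + e c) + ι (β ^ 0 * g b + β ^ 2 * g c) := by
      rw [hlift, hlift, map_add]; abel
    have h' : lift r a + lift r a' = (e a + e a') + ι (β ^ r * g a + β ^ r * g a') := by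
      rw [hlift, hlift, map_add]; abel
    rw [this, h', he₁, hr₁, hr₂, hgb, hgc]
    congr 2
    linear_combination (-β ^ 2 - β ^ 3) * h2
  have heq₂' : lift r a + lift 1 b' = lift 2 c + lift 2 c' := by
    have : lift r a + lift 1 b' = (e a + e b') + ι (β ^ r * g a + β ^ 1 * g b') := by
      rw [hlift, hlift, map_add]; abel
    have h' : lift 2 c + lift 2 c' = (e c + e c') + ι (β ^ 2 * g c + β ^ 2 * g c') := by
      rw [hlift, hlift, map_add]; abel
    rw [this, h', he₂, hr₁, hgb', hgc, hgc']
    congr 2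
    ring
  have hne : ∀ {r s : ℕ} {q q' : B}, q ≠ q' → lift r q ≠ lift s q' := by
    intro r s q q' hq h
    exact hq (by rw [← hφl r q, h, hφl])
  have hgap' : ∀ {Z : List A}, (Y.map (lift r)) <:+: Z →
      [lift r a, lift r a'] <:+: Z ∨ [lift r a', lift r a] <:+: Z := fun hZ =>
    hgap.imp (fun h => (pair_infix_map _ h).trans hZ) (fun h => (pair_infix_map _ h).trans hZ)
  -- For r = 1 the inner step lies in `X'` instead of `Y'`. The relations survive exchanging the two
  -- cuts together with `a` and `a'`.
  by_cases hr1 : r = 1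
  · have hin : Y.map (lift r) <:+: X' := by
      rw [hr1]; exact ⟨X.map (lift 1), X.map (lift 2), by simp [X']⟩
    refine ⟨Y', X', lift r a', lift r a, lift 2 c, lift 2 c', lift 0 b, lift 1 b',
      hcyc.append_comm hX'ne hY'ne, ⟨hY'h, hY'l, hne hc'b⟩, ⟨hX'h, hX'l⟩, (hgap' hin).symm,
      ⟨hne (hXY c hcX a' ha'Y).symm, hne (hXY b' hbX a' ha'Y).symm, hne (hXY c hcX a haY).symm,
        hne (hXY b' hbX a haY).symm⟩, ?_, ?_⟩
    · rw [add_comm, heq₁', add_comm]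
    · have : lift r a' + lift 2 c' =
          (lift r a + lift r a') + (lift 2 c + lift 2 c') - lift r a - lift 2 c := by abel
      rw [this, ← heq₁', ← heq₂']; abel
  · have hin : Y.map (lift r) <:+: Y' := by
      rcases Nat.eq_zero_or_pos r with rfl | hr0
      · exact ⟨Y.map (lift 2) ++ ((List.range' 3 (N - 3)).flatMap p ++
          ((X.map (lift 0)).reverse ++ O)), [], by simp [Y', T]⟩
      · rcases Nat.lt_or_ge r 3 with h3 | h3
        · obtain rfl : r = 2 := by omega
          exact ⟨[], (List.range' 3 (N - 3)).flatMap p ++ T, by simp [Y']⟩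
        · obtain ⟨s, t, hst⟩ := List.append_of_mem
            (show r ∈ List.range' 3 (N - 3) by rw [List.mem_range'_1]; omega)
          refine ⟨Y.map (lift 2) ++ (s.flatMap p ++ X.map (lift r)), t.flatMap p ++ T, ?_⟩
          simp [Y', hst, hp]
    exact ⟨X', Y', lift r a, lift r a', lift 0 b, lift 1 b', lift 2 c, lift 2 c', hcyc,
      ⟨hX'h, hX'l, hne hbc'⟩, ⟨hY'h, hY'l⟩, hgap' hin,
      ⟨hne hab, hne hac', hne ha'b, hne ha'c'⟩, heq₁', heq₂'⟩

theorem exists_pow_generator (F : Type*) [Field F] [Finite F] :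
    ∃ β : F, β ≠ 0 ∧ β ^ (Nat.card F - 1) = 1 ∧
      ∀ x : F, x ≠ 0 → ∃ r < Nat.card F - 1, x = β ^ r := by
  obtain ⟨u, hu⟩ := IsCyclic.exists_generator (α := Fˣ)
  have hcard : Nat.card Fˣ = Nat.card F - 1 := Nat.card_units F
  have ho : orderOf u = Nat.card F - 1 := by rw [orderOf_eq_card_of_forall_mem_zpowers hu, hcard]
  refine ⟨u, u.ne_zero, ?_, fun x hx => ?_⟩
  · rw [← ho, ← Units.val_pow_eq_pow_val, pow_orderOf_eq_one, Units.val_one]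
  · have h1 := hu (Units.mk0 x hx)
    rw [← mem_powers_iff_mem_zpowers, Submonoid.mem_powers_iff] at h1
    obtain ⟨n, hn⟩ := h1
    refine ⟨n % orderOf u, ?_, ?_⟩
    · rw [← ho]; exact Nat.mod_lt _ (orderOf_pos u)
    · rw [← Units.val_pow_eq_pow_val, pow_mod_orderOf, hn, Units.val_mk0]

/-- A field structure on the kernel provides a generator β that permutes the nonzero kernel elements
cyclically. -/
theorem exists_field_addEquiv (K : Type*) [AddCommGroup K] [Finite K] [Nontrivial K]
    (h : ∀ x : K, x + x = 0) :
    ∃ (F : Type) (_ : Field F) (_ : Finite F), (1 : F) + 1 = 0 ∧ Nonempty (F ≃+ K) := by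
  let _ : Module (ZMod 2) K := AddCommGroup.zmodModule (n := 2) fun x => by rw [two_nsmul, h]
  set k := Module.finrank (ZMod 2) K
  have hk : k ≠ 0 := Module.finrank_pos.ne'
  refine ⟨GaloisField 2 k, inferInstance, inferInstance, ?_, ?_⟩
  · have := CharP.cast_eq_zero (GaloisField 2 k) 2
    rw [one_add_one_eq_two]; exact_mod_cast this
  · exact ⟨(LinearEquiv.ofFinrankEq (R := ZMod 2) (GaloisField 2 k) K
      (GaloisField.finrank 2 hk)).toAddEquiv⟩

/-- Switches lift along surjections whose kernel is an elementary abelian `2`-group of order at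
least four. -/
theorem HasSwitch.of_surjective {A B : Type*} [AddCommGroup A] [AddCommGroup B] [Finite A]
    (φ : A →+ B) (hφ : Function.Surjective φ) (h2 : ∀ x ∈ φ.ker, x + x = 0)
    (h4 : 4 * Nat.card B ≤ Nat.card A) (hB : HasSwitch B) : HasSwitch A := by
  have : Finite B := Finite.of_surjective φ hφ
  have hmul : Nat.card A = Nat.card B * Nat.card φ.ker := by
    rw [AddSubgroup.card_eq_card_quotient_mul_card_addSubgroup φ.ker,
      Nat.card_congr (QuotientAddGroup.quotientKerEquivOfSurjective φ hφ).toEquiv]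
  have h4' : 4 ≤ Nat.card φ.ker := by
    rw [hmul, mul_comm] at h4
    exact Nat.le_of_mul_le_mul_left h4 Nat.card_pos
  have : Nontrivial φ.ker := Finite.one_lt_card_iff_nontrivial.1 (by omega)
  obtain ⟨F, _, _, hF2, ⟨f⟩⟩ := exists_field_addEquiv φ.ker
    fun x => Subtype.ext (h2 x x.2)
  have hcF : Nat.card F = Nat.card φ.ker := Nat.card_congr f.toEquiv
  have hcard : Nat.card A = Nat.card F * Nat.card B := by
    rw [hmul, hcF, mul_comm]
  obtain ⟨β, hβ0, hβN, hgen⟩ := exists_pow_generator F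
  obtain ⟨N, hN⟩ : ∃ N, Nat.card F = N + 1 := ⟨Nat.card F - 1, by omega⟩
  rw [hN, Nat.add_sub_cancel] at hβN hgen
  have hβ1 : β ≠ 1 := by
    rintro rfl
    obtain ⟨x, hx0, hx1, -⟩ := exists_ne_zero_of_four_le (F := F) (by omega) 1 1
    obtain ⟨r, -, hr⟩ := hgen x hx0
    exact hx1 (by rw [hr, one_pow])
  refine HasSwitch.lift φ hφ (φ.ker.subtype.comp f.toAddMonoidHom) (fun κ => (f κ).2)
    (fun x hx => ⟨f.symm ⟨x, hx⟩, ?_⟩) (N := N) (by omega) hN (by rw [hcard, hN]) hβ0 hβ1 hβN hgen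
    hF2 hB
  simp

/-! ### Explicit cycles in small groups. -/

theorem exists_pair_of_mem_zipWith {A : Type*} [AddCommGroup A] {y w : A} {t : List A} {x : A}
    (h : y ∈ List.zipWith (· + ·) (x :: t) (t ++ [w])) :
    ∃ u v, [u, v] <:+: (x :: t) ++ [w] ∧ u + v = y := by
  induction t generalizing x with
  | nil =>
    simp at h
    exact ⟨x, w, by simp, h.symm⟩
  | cons z t ih =>
    rw [List.cons_append, List.zipWith_cons_cons, List.mem_cons] at h
    rcases h with rfl | h
    · exact ⟨x, z, pair_infix_cons.2 (Or.inl ⟨rfl, rfl⟩), rfl⟩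
    · obtain ⟨u, v, huv, hy⟩ := ih h
      exact ⟨u, v, pair_infix_cons.2 (Or.inr huv), hy⟩

theorem exists_cyclicAdj_of_mem_zipWith {A : Type*} [AddCommGroup A] {y x : A} {t : List A}
    (h : y ∈ List.zipWith (· + ·) (x :: t) (t ++ [x])) :
    ∃ u v, CyclicAdj (x :: t) u v ∧ u + v = y := by
  obtain ⟨u, v, huv, hy⟩ := exists_pair_of_mem_zipWith h
  refine ⟨u, v, ?_, hy⟩
  rcases pair_infix_append.1 huv with h | h | ⟨h, h'⟩
  · exact Or.inl h
  · simp [pair_infix_cons] at h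
  · simp at h'; subst h'; exact Or.inr ⟨h, rfl⟩

/-- Puts the cyclic sums into one explicit list, so that concrete cycles can be checked by `decide`.
-/
theorem IsHarmonicCycle.of_mem_zipWith {A : Type*} [AddCommGroup A] {x : A} {t : List A}
    (hl : (x :: t).length = Nat.card A) (hm : ∀ y, y ∈ x :: t)
    (hs : ∀ y, y ∈ List.zipWith (· + ·) (x :: t) (t ++ [x])) : IsHarmonicCycle (x :: t) where
  length_eq := hl
  mem := hm
  sum y := exists_cyclicAdj_of_mem_zipWith (hs y)

theorem hasSwitch_two_four : HasSwitch (ZMod 2 × ZMod 4) := by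
  refine ⟨[(1, 1), (1, 2), (1, 0)], [(0, 2), (0, 3), (0, 1), (1, 3), (0, 0)], (0, 1), (1, 3),
    (0, 0), (1, 1), (1, 0), (0, 2), IsHarmonicCycle.of_mem_zipWith (by simp) (by decide)
    (by decide), by decide, by decide, by decide, by decide, by decide⟩

theorem hasSwitch_four_four : HasSwitch (ZMod 4 × ZMod 4) := by
  refine ⟨[(0, 2), (1, 1), (0, 3), (2, 1)], [(2, 2), (3, 0), (1, 0), (1, 2), (3, 3), (0, 1),
    (2, 0), (1, 3), (2, 3), (3, 2), (3, 1), (0, 0)], (0, 1), (2, 0),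
    (0, 0), (0, 2), (2, 1), (2, 2), IsHarmonicCycle.of_mem_zipWith (by simp) (by decide)
    (by decide), by decide, by decide, by decide, by decide, by decide⟩

theorem hasSwitch_two_two_four : HasSwitch (ZMod 2 × ZMod 2 × ZMod 4) := by
  refine ⟨[(1, 0, 1), (1, 0, 2), (1, 1, 0), (1, 1, 1), (1, 1, 3), (0, 1, 3), (1, 1, 2)],
    [(0, 0, 1), (0, 1, 0), (1, 0, 0), (0, 1, 2), (1, 0, 3), (0, 0, 0), (0, 0, 2), (0, 1, 1),
      (0, 0, 3)], (0, 1, 2), (1, 0, 3),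
    (0, 0, 3), (1, 0, 1), (1, 1, 2), (0, 0, 1), IsHarmonicCycle.of_mem_zipWith (by simp)
    (by decide) (by decide), by decide, by decide, by decide, by decide, by decide⟩

theorem hasSwitch_two_two_three : HasSwitch (ZMod 2 × ZMod 2 × ZMod 3) := by
  refine ⟨[(1, 1, 0), (1, 0, 0)], [(0, 1, 2), (0, 1, 0), (0, 1, 1), (0, 0, 1), (1, 0, 1),
    (0, 0, 2), (1, 0, 2), (1, 1, 2), (1, 1, 1), (0, 0, 0)], (0, 0, 2), (1, 0, 1),
    (0, 0, 0), (1, 1, 0), (1, 0, 0), (0, 1, 2), IsHarmonicCycle.of_mem_zipWith (by simp)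
    (by decide) (by decide), by decide, by decide, by decide, by decide, by decide⟩

theorem hasSwitch_two_two_five : HasSwitch (ZMod 2 × ZMod 2 × ZMod 5) := by
  refine ⟨[(0, 0, 4), (1, 1, 3), (1, 1, 1), (0, 0, 3), (0, 1, 3), (1, 0, 2), (0, 1, 1), (0, 1, 2),
    (0, 1, 4), (1, 1, 0)], [(1, 0, 4), (1, 1, 4), (1, 0, 3), (1, 1, 2), (0, 1, 0), (1, 0, 1),
    (0, 0, 2), (0, 0, 0), (1, 0, 0), (0, 0, 1)], (0, 1, 0), (1, 0, 1),
    (0, 0, 1), (0, 0, 4), (1, 1, 0), (1, 0, 4), IsHarmonicCycle.of_mem_zipWith (by simp)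
    (by decide) (by decide), by decide, by decide, by decide, by decide, by decide⟩

/-- Rank three needs its own cycle: the projection to rank two has a kernel of order 2, too small
for lifting. Higher ranks do not build on it, so no switch is needed. -/
theorem harmonic_two_two_two_three : Harmonic (ZMod 2 × ZMod 2 × ZMod 2 × ZMod 3) := by
  refine IsHarmonicCycle.harmonic (l := [(0, 0, 0, 0), (1, 1, 1, 0), (0, 0, 0, 2), (1, 1, 0, 2),
    (0, 1, 1, 2), (0, 0, 1, 0), (1, 0, 0, 2), (1, 0, 1, 1), (1, 0, 1, 0), (0, 0, 1, 2),
    (0, 1, 0, 0), (0, 1, 0, 2), (0, 1, 0, 1), (1, 1, 1, 2), (1, 0, 0, 1), (0, 1, 1, 0),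
    (1, 1, 1, 1), (1, 1, 0, 0), (1, 0, 0, 0), (1, 1, 0, 1), (0, 0, 0, 1), (0, 0, 1, 1),
    (1, 0, 1, 2), (0, 1, 1, 1)]) (IsHarmonicCycle.of_mem_zipWith (by simp) (by decide) (by decide))

set_option maxRecDepth 4000 in
theorem harmonic_two_two_two_five : Harmonic (ZMod 2 × ZMod 2 × ZMod 2 × ZMod 5) := by
  refine IsHarmonicCycle.harmonic (l := [(0, 0, 0, 0), (0, 0, 0, 1), (1, 1, 0, 1), (1, 0, 1, 0),
    (0, 1, 1, 4), (0, 0, 1, 2), (0, 0, 1, 1), (1, 0, 1, 2), (1, 1, 0, 3), (1, 1, 0, 2),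
    (1, 1, 1, 4), (1, 1, 0, 4), (0, 1, 0, 2), (1, 0, 0, 1), (1, 0, 1, 3), (1, 0, 0, 4),
    (0, 0, 1, 0), (1, 0, 0, 3), (0, 1, 0, 3), (1, 1, 1, 3), (1, 0, 1, 4), (0, 1, 0, 1),
    (0, 0, 0, 2), (0, 1, 1, 0), (0, 0, 0, 4), (0, 0, 0, 3), (1, 1, 1, 0), (0, 1, 1, 2),
    (1, 0, 0, 0), (1, 1, 0, 0), (0, 0, 1, 4), (1, 1, 1, 1), (1, 0, 0, 2), (0, 0, 1, 3),
    (1, 0, 1, 1), (0, 1, 0, 0), (1, 1, 1, 2), (0, 1, 1, 3), (0, 1, 1, 1), (0, 1, 0, 4)])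
    (IsHarmonicCycle.of_mem_zipWith (by simp) (by decide) (by decide))

/-! ### The groups ℤ/2 × ℤ/2^m, by doubling. -/

/-- `P ++ S` is a cycle in `ℤ/2 × ℤ` that becomes harmonic modulo `2 * c`, and whose second half `S`
is a rearrangement of the translate of `P` by `c`. -/
structure IsDoublingCycle (c : ℤ) (P S : List (ZMod 2 × ℤ)) (x : ZMod 2 × ℤ) : Prop where
  perm : S.Perm (P.map (· + (0, c)))
  head_left : P.head? = some x
  head_right : S.head? = some (x + (0, c))
  mem : ∀ y, ∃ z ∈ P ++ S, ∃ k : ℤ, y = z + (0, 2 * c * k)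
  sum : ∀ y, ∃ u v, CyclicAdj (P ++ S) u v ∧ ∃ k : ℤ, y = u + v + (0, 2 * c * k)

/-- Modulo 4c each old sum must occur both unchanged and shifted by 2c. Steps inside `P` recur
shifted by 6c, steps inside `S` by 2c. The step from `P` to `S` recurs, shifted by 2c, as the new
closing step. The old closing step becomes the two junctions leaving `S` and `S + c`, with shifts 2c
and 4c. -/
theorem IsDoublingCycle.double {c : ℤ} {P S : List (ZMod 2 × ℤ)} {x : ZMod 2 × ℤ}
    (h : IsDoublingCycle c P S x) :
    IsDoublingCycle (2 * c) (P ++ S) (S.map (· + (0, c)) ++ P.map (· + (0, 3 * c))) x := by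
  have hP : P ≠ [] := by intro h'; have := h.head_left; simp [h'] at this
  have hS : S ≠ [] := by intro h'; have := h.head_right; simp [h'] at this
  have hSm : S.map (· + ((0 : ZMod 2), c)) ≠ [] := by simpa using hS
  have hPm : P.map (· + ((0 : ZMod 2), 3 * c)) ≠ [] := by simpa using hP
  have hadd : ∀ (z : ZMod 2 × ℤ) (s t : ℤ), z + (0, s) + (0, t) = z + (0, s + t) := by
    intro z s t; ext <;> simp [add_assoc]
  have hperm : (S.map (· + (0, c)) ++ P.map (· + (0, 3 * c))).Perm
      ((P ++ S).map (· + (0, 2 * c))) := by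
    have h1 := h.perm.map (· + ((0 : ZMod 2), c))
    have h2 := h.perm.map (· + ((0 : ZMod 2), 2 * c))
    rw [List.map_map] at h1 h2
    rw [List.map_append]
    refine (h1.trans (.of_eq ?_)).append (List.Perm.trans (.of_eq ?_) h2.symm) <;>
    · refine List.map_congr_left fun z _ => ?_
      simp only [Function.comp_apply, hadd]
      congr 2; ring
  refine ⟨hperm, ?_, ?_, fun y => ?_, fun y => ?_⟩
  · rw [List.head?_append_of_ne_nil _ hP, h.head_left]
  · rw [List.head?_append_of_ne_nil _ hSm, List.head?_map, h.head_right, Option.map_some, hadd]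
    congr 3; ring
  · obtain ⟨z, hz, k, rfl⟩ := h.mem y
    obtain ⟨j, rfl | rfl⟩ := Int.even_or_odd' k
    · exact ⟨z, List.mem_append.2 (Or.inl hz), j, by congr 2; ring⟩
    · refine ⟨z + (0, 2 * c), List.mem_append.2 (Or.inr (hperm.mem_iff.2
        (List.mem_map_of_mem hz))), j, ?_⟩
      rw [hadd]; congr 2; ring
  · obtain ⟨u, v, huv, k, rfl⟩ := h.sum y
    have key : ∀ {u' v'} (s t : ℤ), CyclicAdj ((P ++ S) ++ (S.map (· + ((0 : ZMod 2), c)) ++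
          P.map (· + ((0 : ZMod 2), 3 * c)))) u' v' → u' + v' = u + v + (0, s) →
          s + 2 * (2 * c) * t = 2 * c * k →
        ∃ u' v', CyclicAdj ((P ++ S) ++ (S.map (· + (0, c)) ++ P.map (· + (0, 3 * c)))) u' v' ∧
          ∃ j : ℤ, u + v + (0, 2 * c * k) = u' + v' + (0, 2 * (2 * c) * j) := by
      intro u' v' s t h1 h2 h3
      exact ⟨u', v', h1, t, by rw [h2, hadd, h3]⟩
    have inl : ∀ {u' v'}, [u', v'] <:+: P ++ S → CyclicAdj ((P ++ S) ++
        (S.map (· + ((0 : ZMod 2), c)) ++ P.map (· + ((0 : ZMod 2), 3 * c)))) u' v' := fun h =>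
      Or.inl (pair_infix_append.2 (Or.inl h))
    have inr : ∀ {u' v'}, [u', v'] <:+: (S.map (· + ((0 : ZMod 2), c)) ++
        P.map (· + ((0 : ZMod 2), 3 * c))) → CyclicAdj ((P ++ S) ++
        (S.map (· + ((0 : ZMod 2), c)) ++ P.map (· + ((0 : ZMod 2), 3 * c)))) u' v' := fun h =>
      Or.inl (pair_infix_append.2 (Or.inr (Or.inl h)))
    obtain ⟨j, rfl | rfl⟩ := Int.even_or_odd' k
    · rcases huv with huv | ⟨h1, h2⟩
      · exact key 0 j (inl huv) (by simp) (by ring)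
      · rw [List.getLast?_append_of_ne_nil _ hS] at h1
        rw [List.head?_append_of_ne_nil _ hP] at h2
        refine key (u' := u + (0, c)) (v' := v + (0, 3 * c)) (4 * c) (j - 1)
          (inr (pair_infix_append.2 (Or.inr (Or.inr ⟨?_, ?_⟩)))) ?_ (by ring)
        · rw [List.getLast?_map, h1]; rfl
        · rw [List.head?_map, h2]; rfl
        · ext <;> simp; ring
    · rcases huv with huv | ⟨h1, h2⟩
      · rcases pair_infix_append.1 huv with huv | huv | ⟨h1, h2⟩
        · refine key (6 * c) (j - 1) (inr (pair_infix_append.2 (Or.inr (Or.inl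
            (pair_infix_map _ huv))))) ?_ (by ring)
          ext <;> simp; ring
        · refine key (2 * c) j (inr (pair_infix_append.2 (Or.inl (pair_infix_map _ huv)))) ?_
            (by ring)
          ext <;> simp; ring
        · rw [h.head_right, Option.some_inj] at h2
          refine key (u' := u + (0, 3 * c)) (v' := x) (2 * c) j (Or.inr ⟨?_, ?_⟩) ?_ (by ring)
          · rw [List.getLast?_append_of_ne_nil _ (by simp [hP]),
              List.getLast?_append_of_ne_nil _ hPm, List.getLast?_map, h1]; rfl
          · rw [List.head?_append_of_ne_nil _ (by simp [hP]),
              List.head?_append_of_ne_nil _ hP, h.head_left]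
          · rw [← h2]; ext <;> simp; ring
      · rw [List.getLast?_append_of_ne_nil _ hS] at h1
        rw [List.head?_append_of_ne_nil _ hP, h.head_left, Option.some_inj] at h2
        refine key (u' := u) (v' := x + (0, c) + (0, c)) (2 * c) j
          (Or.inl (pair_infix_append.2 (Or.inr (Or.inr ⟨?_, ?_⟩)))) ?_ (by ring)
        · rw [List.getLast?_append_of_ne_nil _ hS, h1]
        · rw [List.head?_append_of_ne_nil _ hSm, List.head?_map, h.head_right]; rfl
        · rw [h2]; ext <;> simp; ring

/-- Doubling only appends, so the eight initial terms, which carry the switch, persist for every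
`n`. -/
theorem IsDoublingCycle.exists_cycle (n : ℕ) : ∃ T S : List (ZMod 2 × ℤ),
    IsDoublingCycle (2 ^ (n + 2)) ([(0, 0), (0, 2), (0, 3), (1, 4), (0, 1), (1, 7), (1, 1), (1, 2)]
      ++ T) S (0, 0) ∧ T.length + 8 = 2 ^ (n + 3) := by
  induction n with
  | zero =>
    have hfin : ∀ l : List (ZMod 2 × ℤ), (∀ (i : ZMod 2) (r : Fin 8), ∃ z ∈ l,
        z.1 = i ∧ (8 : ℤ) ∣ ((r : ℕ) : ℤ) - z.2) →
        ∀ y, ∃ z ∈ l, ∃ k : ℤ, y = z + (0, 2 * 2 ^ (0 + 2) * k) := by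
      rintro l hl ⟨i, r⟩
      obtain ⟨z, hz, rfl, k, hk⟩ := hl i ⟨(r % 8).toNat, by omega⟩
      refine ⟨z, hz, k + r / 8, ?_⟩
      ext
      · simp
      · simp only [Prod.snd_add] at hk ⊢
        omega
    -- Entries such as 8 and 11 stay unreduced, since the rearrangement property is required over ℤ.
    refine ⟨[], [(0, 4), (1, 8), (1, 6), (1, 11), (0, 6), (1, 5), (0, 5), (0, 7)],
      ⟨by decide, rfl, rfl, hfin _ (by decide), fun y => ?_⟩, rfl⟩
    obtain ⟨z, hz, k, hk⟩ := hfin (List.zipWith (· + ·) [(0, 0), (0, 2), (0, 3), (1, 4), (0, 1),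
      (1, 7), (1, 1), (1, 2), (0, 4), (1, 8), (1, 6), (1, 11), (0, 6), (1, 5), (0, 5), (0, 7)]
      ([(0, 2), (0, 3), (1, 4), (0, 1), (1, 7), (1, 1), (1, 2), (0, 4), (1, 8), (1, 6), (1, 11),
      (0, 6), (1, 5), (0, 5), (0, 7)] ++ [(0, 0)])) (by decide) y
    obtain ⟨u, v, huv, rfl⟩ := exists_cyclicAdj_of_mem_zipWith hz
    exact ⟨u, v, huv, k, hk⟩
  | succ n ih =>
    obtain ⟨T, S, h, hT⟩ := ih
    have hd := h.double
    rw [← pow_succ', List.append_assoc] at hd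
    refine ⟨T ++ S, _, hd, ?_⟩
    have := h.perm.length_eq
    simp only [List.length_map, List.length_append, List.length_cons, List.length_nil] at this
    rw [List.length_append, this, pow_succ]
    omega

theorem hasSwitch_two_two_pow (n : ℕ) : HasSwitch (ZMod 2 × ZMod (2 ^ (n + 3))) := by
  obtain ⟨T, S, h, hT⟩ := IsDoublingCycle.exists_cycle n
  let π : ZMod 2 × ℤ →+ ZMod 2 × ZMod (2 ^ (n + 3)) :=
    (AddMonoidHom.id (ZMod 2)).prodMap (Int.castAddHom (ZMod (2 ^ (n + 3))))
  have hπ : Function.Surjective π := by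
    rintro ⟨i, r⟩
    obtain ⟨r, rfl⟩ := ZMod.intCast_surjective r
    exact ⟨(i, r), rfl⟩
  have hπk : ∀ z k, π (z + (0, 2 * 2 ^ (n + 2) * k)) = π z := by
    intro z k
    rw [map_add, add_eq_left]
    have : ((2 * 2 ^ (n + 2) * k : ℤ) : ZMod (2 ^ (n + 3))) = 0 := by
      rw [← pow_succ', Int.cast_mul]
      have := ZMod.natCast_self (2 ^ (n + 3))
      push_cast at this ⊢
      rw [this, zero_mul]
    exact Prod.ext rfl this
  have hcyc : IsHarmonicCycle (([(0, 0), (0, 2), (0, 3), (1, 4), (0, 1), (1, 7), (1, 1), (1, 2)]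
      ++ T ++ S).map π) := by
    refine ⟨?_, fun y => ?_, fun y => ?_⟩
    · have := h.perm.length_eq
      simp only [List.length_map, List.length_append, List.length_cons, List.length_nil] at this ⊢
      rw [this, Nat.card_prod, Nat.card_zmod, Nat.card_zmod]
      omega
    · obtain ⟨y, rfl⟩ := hπ y
      obtain ⟨z, hz, k, rfl⟩ := h.mem y
      rw [hπk]
      exact List.mem_map_of_mem hz
    · obtain ⟨y, rfl⟩ := hπ y
      obtain ⟨u, v, huv, k, rfl⟩ := h.sum y
      exact ⟨π u, π v, huv.map π, by rw [hπk, map_add]⟩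
  have hsplit : ([(0, 0), (0, 2), (0, 3), (1, 4), (0, 1), (1, 7), (1, 1), (1, 2)] ++ T ++ S).map π =
      [π (0, 0), π (0, 2), π (0, 3), π (1, 4)] ++
        ([π (0, 1), π (1, 7), π (1, 1)] ++ (π (1, 2) :: (T ++ S).map π)) := by simp
  rw [hsplit] at hcyc
  have hcyc' := hcyc.append_comm (by simp) (by simp)
  rw [List.append_assoc] at hcyc'
  have hne : ∀ {i j : ZMod 2} {r s : ℤ}, i ≠ j → π (i, r) ≠ π (j, s) := fun hij h =>
    hij (congrArg Prod.fst h)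
  -- Both relations already hold in ℤ/2 × ℤ, and the required inequalities are visible in the first
  -- coordinate, so one choice serves every modulus.
  refine ⟨_, _, π (0, 2), π (0, 3), π (1, 4), π (0, 1), π (1, 1), π (1, 2), hcyc',
    ⟨rfl, rfl, hne (by decide)⟩, ⟨rfl, ?_⟩, Or.inl ⟨(π (1, 2) :: (T ++ S).map π) ++ [π (0, 0)],
      [π (1, 4)], by simp⟩,
    ⟨hne (by decide), hne (by decide), hne (by decide), hne (by decide)⟩, ?_, ?_⟩
  · rw [List.getLast?_append_of_ne_nil _ (by simp)]; rfl
  · rw [← map_add, ← map_add]; rfl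
  · rw [← map_add, ← map_add]; rfl

/-! ### Cyclic groups of odd order. -/

theorem ZMod.exists_natCast_eq_of_window {n : ℕ} [NeZero n] (s : ℕ) (x : ZMod n) :
    ∃ i : ℕ, s ≤ i ∧ i < s + n ∧ (i : ZMod n) = x :=
  ⟨s + (x - (s : ZMod n)).val, by omega, by have := ZMod.val_lt (x - (s : ZMod n)); omega, by simp⟩

theorem ZMod.natCast_ne_of_window {n i j : ℕ} (h : i < j) (h' : j < i + n) :
    (i : ZMod n) ≠ j := by
  intro hij
  rw [ZMod.natCast_eq_natCast_iff, Nat.modEq_iff_dvd' h.le] at hij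
  have := Nat.le_of_dvd (by omega) hij
  omega

/-- Consecutive residues form a harmonic cycle of a cyclic group of odd order. -/
theorem isHarmonicCycle_range' {n : ℕ} (hn : Odd n) (s : ℕ) :
    IsHarmonicCycle ((List.range' s n).map (Nat.cast : ℕ → ZMod n)) := by
  obtain ⟨h, rfl⟩ := hn
  refine ⟨by simp, fun x => ?_, fun y => ?_⟩
  · obtain ⟨i, h1, h2, rfl⟩ := ZMod.exists_natCast_eq_of_window s x
    exact List.mem_map_of_mem (List.mem_range'_1.2 ⟨h1, h2⟩)
  · obtain ⟨i, h1, h2, hi⟩ := ZMod.exists_natCast_eq_of_window s ((y - 1) * ((h : ZMod (2 * h + 1)) + 1))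
    refine ⟨(i : ℕ), (i + 1 : ℕ), ?_, ?_⟩
    · rcases Nat.lt_or_ge (i + 1) (s + (2 * h + 1)) with h3 | h3
      · exact Or.inl (pair_infix_map _ (pair_infix_range' h1 h3))
      · obtain rfl : i = s + 2 * h := by omega
        refine Or.inr ⟨?_, ?_⟩
        · rw [List.range'_1_concat]; simp
        · rw [List.range'_succ, List.map_cons, List.head?_cons]
          have := ZMod.natCast_self (2 * h + 1)
          congr 1
          push_cast at this ⊢
          linear_combination -this
    · have := ZMod.natCast_self (2 * h + 1)
      push_cast at this ⊢
      rw [hi]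
      linear_combination (y - 1) * this

/-- For consecutive residues the switch relations reduce to 3(c - a) = 1 when a' = a + 1, and to 3(a
- c) = 1 when a' = a - 1; hence 3 must be invertible. The class of n modulo 3 selects the convenient
case, and n ≥ 7 keeps `a` and `a'` off the ends of `Y`. -/
theorem hasSwitch_zmod {n : ℕ} (hn : Odd n) (h7 : 7 ≤ n) (h3 : ¬ 3 ∣ n) : HasSwitch (ZMod n) := by
  have hhead : ∀ s k : ℕ, 0 < k → ((List.range' s k).map (Nat.cast : ℕ → ZMod n)).head? =
      some (s : ZMod n) := by
    intro s k hk
    obtain ⟨k, rfl⟩ := Nat.exists_eq_succ_of_ne_zero hk.ne'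
    simp [List.range'_succ]
  have hlast : ∀ s k t : ℕ, 0 < k → t + 1 = s + k →
      ((List.range' s k).map (Nat.cast : ℕ → ZMod n)).getLast? = some (t : ZMod n) := by
    intro s k t hk ht
    obtain ⟨k, rfl⟩ := Nat.exists_eq_succ_of_ne_zero hk.ne'
    obtain rfl : t = s + k := by omega
    rw [List.range'_1_concat]; simp
  have hcyc : ∀ s k l : ℕ, k + l = n → IsHarmonicCycle
      ((List.range' s k).map (Nat.cast : ℕ → ZMod n) ++ (List.range' (s + k) l).map Nat.cast) := by
    rintro s k l rfl
    rw [← List.map_append, List.range'_append_1]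
    exact isHarmonicCycle_range' hn s
  have hpair : ∀ s k i : ℕ, s ≤ i → i + 1 < s + k →
      [(i : ZMod n), ((i + 1 : ℕ) : ZMod n)] <:+: (List.range' s k).map Nat.cast :=
    fun s k i h1 h2 => pair_infix_map _ (pair_infix_range' h1 h2)
  have hcases : n % 3 = 1 ∨ n % 3 = 2 := by omega
  rcases hcases with h | h
  · obtain ⟨q, rfl⟩ : ∃ q, n = 3 * q + 1 := ⟨n / 3, by omega⟩
    refine ⟨_, _, (4 * q + 1 : ℕ), (4 * q + 1 + 1 : ℕ), (5 * q + 2 : ℕ), (2 * q + 2 : ℕ),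
      (3 * q + 1 : ℕ), (2 * q + 2 + q : ℕ), hcyc (2 * q + 2) q (2 * q + 1) (by omega),
      ⟨hhead _ _ (by omega), hlast _ _ _ (by omega) (by omega),
        ZMod.natCast_ne_of_window (by omega) (by omega)⟩,
      ⟨hhead _ _ (by omega), hlast _ _ _ (by omega) (by omega)⟩,
      Or.inl (hpair _ _ _ (by omega) (by omega)),
      ⟨ZMod.natCast_ne_of_window (by omega) (by omega),
        (ZMod.natCast_ne_of_window (by omega) (by omega)).symm,
        ZMod.natCast_ne_of_window (by omega) (by omega),
        (ZMod.natCast_ne_of_window (by omega) (by omega)).symm⟩, ?_, ?_⟩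
    · rw [← Nat.cast_add, ← Nat.cast_add]; congr 1; ring
    · rw [← Nat.cast_add, ← Nat.cast_add]; congr 1; ring
  · obtain ⟨q, rfl⟩ : ∃ q, n = 3 * q + 2 := ⟨n / 3, by omega⟩
    refine ⟨_, _, (2 * q + 1 + 1 : ℕ), (2 * q + 1 : ℕ), (3 * q + 2 : ℕ), (1 : ℕ),
      (q + 1 : ℕ), (1 + (q + 1) : ℕ), hcyc 1 (q + 1) (2 * q + 1) (by omega),
      ⟨hhead _ _ (by omega), hlast _ _ _ (by omega) (by omega),
        ZMod.natCast_ne_of_window (by omega) (by omega)⟩,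
      ⟨hhead _ _ (by omega), hlast _ _ _ (by omega) (by omega)⟩,
      Or.inr (hpair _ _ _ (by omega) (by omega)),
      ⟨ZMod.natCast_ne_of_window (by omega) (by omega),
        (ZMod.natCast_ne_of_window (by omega) (by omega)).symm,
        ZMod.natCast_ne_of_window (by omega) (by omega),
        (ZMod.natCast_ne_of_window (by omega) (by omega)).symm⟩, ?_, ?_⟩
    · rw [← Nat.cast_add, ← Nat.cast_add]; congr 1; ring
    · rw [← Nat.cast_add, ← Nat.cast_add]; congr 1; ring

/-! ### Products of an elementary 2-group with ℤ/p. -/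

/-- From rank four on, the projection to rank two has a kernel of order at least four, and the
switch lifts. -/
theorem harmonic_elementary_prod_of_base {P : Type*} [AddCommGroup P] [Finite P] {p : ℕ} [NeZero p]
    (hP : ∀ x : P, x + x = 0) (h4 : 4 ≤ Nat.card P)
    (h2 : HasSwitch (ZMod 2 × ZMod 2 × ZMod p))
    (h3 : Harmonic (ZMod 2 × ZMod 2 × ZMod 2 × ZMod p)) : Harmonic (P × ZMod p) := by
  let _ : Module (ZMod 2) P := AddCommGroup.zmodModule (n := 2) fun x => by rw [two_nsmul, hP]
  have hcard : Nat.card P = 2 ^ Module.finrank (ZMod 2) P := by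
    rw [Module.natCard_eq_pow_finrank (K := ZMod 2), Nat.card_zmod]
  obtain ⟨k, hk⟩ : ∃ k, Module.finrank (ZMod 2) P = k + 2 := by
    refine ⟨Module.finrank (ZMod 2) P - 2, ?_⟩
    rw [hcard] at h4
    have : 2 ≤ Module.finrank (ZMod 2) P :=
      (Nat.pow_le_pow_iff_right (a := 2) (by norm_num)).1 (by simpa using h4)
    omega
  rcases k with _ | _ | k
  · have f : P ≃ₗ[ZMod 2] ZMod 2 × ZMod 2 := LinearEquiv.ofFinrankEq _ _ (by simp [hk])
    exact h2.harmonic.of_addEquiv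
      ((f.toAddEquiv.prodCongr (AddEquiv.refl _)).trans AddEquiv.prodAssoc).symm
  · have f : P ≃ₗ[ZMod 2] ZMod 2 × ZMod 2 × ZMod 2 := LinearEquiv.ofFinrankEq _ _ (by simp [hk])
    exact h3.of_addEquiv ((f.toAddEquiv.prodCongr (AddEquiv.refl _)).trans
      (AddEquiv.prodAssoc.trans ((AddEquiv.refl _).prodCongr AddEquiv.prodAssoc))).symm
  · have f : P ≃ₗ[ZMod 2] (ZMod 2 × ZMod 2) × (Fin (k + 2) → ZMod 2) :=
      LinearEquiv.ofFinrankEq _ _ (by simp [hk]; omega)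
    have hs := h2.of_addEquiv AddEquiv.prodAssoc.symm
    refine (HasSwitch.of_surjective
      (((AddMonoidHom.fst _ _).comp f.toAddEquiv.toAddMonoidHom).prodMap
        (AddMonoidHom.id (ZMod p))) ?_ ?_ ?_ hs).harmonic
    · exact Function.Surjective.prodMap (Prod.fst_surjective.comp f.surjective)
        Function.surjective_id
    · rintro ⟨x, y⟩ hxy
      have hy : y = 0 := congrArg Prod.snd hxy
      exact Prod.ext (hP x) (by simp [hy])
    · simp only [Nat.card_prod, Nat.card_zmod, hcard, hk]
      rw [← mul_assoc]
      refine Nat.mul_le_mul_right _ ?_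
      have := Nat.one_le_two_pow (n := k)
      rw [show k + 1 + 1 + 2 = k + 4 by ring, pow_add]; omega

theorem harmonic_elementary_prod {P : Type*} [AddCommGroup P] [Finite P] {p : ℕ} (hp : p.Prime)
    (hp2 : p ≠ 2) (hP : ∀ x : P, x + x = 0) (h4 : 4 ≤ Nat.card P) : Harmonic (P × ZMod p) := by
  have : NeZero p := ⟨hp.ne_zero⟩
  by_cases h3 : p = 3
  · subst h3
    exact harmonic_elementary_prod_of_base hP h4 hasSwitch_two_two_three harmonic_two_two_two_three
  by_cases h5 : p = 5
  · subst h5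
    exact harmonic_elementary_prod_of_base hP h4 hasSwitch_two_two_five harmonic_two_two_two_five
  have hodd : Odd p := hp.odd_of_ne_two hp2
  have h7 : 7 ≤ p := by
    obtain ⟨s, hs⟩ := hodd
    have := hp.two_le
    omega
  have hdvd : ¬ 3 ∣ p := fun h => h3 ((Nat.prime_dvd_prime_iff_eq Nat.prime_three hp).1 h).symm
  refine (HasSwitch.of_surjective (AddMonoidHom.snd P (ZMod p)) Prod.snd_surjective ?_ ?_
    (hasSwitch_zmod hodd h7 hdvd)).harmonic
  · rintro ⟨x, y⟩ hxy
    have hy : y = 0 := hxy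
    exact Prod.ext (hP x) (by simp [hy])
  · rw [Nat.card_prod]
    exact Nat.mul_le_mul_right _ h4

/-! ### Noncyclic, nonelementary 2-groups. -/

/-- Exactly two exponents drop by one, so the kernel of the coordinatewise reduction is a Klein
four-group. -/
theorem HasSwitch.pi_of_sum_eq {ι : Type*} [Fintype ι] {e e' : ι → ℕ} (h₁ : ∀ i, e' i ≤ e i)
    (h₂ : ∀ i, e i ≤ e' i + 1) (hsum : ∑ i, e' i + 2 = ∑ i, e i)
    (h : HasSwitch (∀ i, ZMod (2 ^ e' i))) : HasSwitch (∀ i, ZMod (2 ^ e i)) := by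
  have hcard : ∀ f : ι → ℕ, Nat.card (∀ i, ZMod (2 ^ f i)) = 2 ^ ∑ i, f i := by
    intro f
    rw [Nat.card_pi, ← Finset.prod_pow_eq_pow_sum]
    exact Finset.prod_congr rfl fun i _ => Nat.card_zmod _
  let φ : (∀ i, ZMod (2 ^ e i)) →+ ∀ i, ZMod (2 ^ e' i) :=
    { toFun := fun x i => ZMod.castHom (pow_dvd_pow 2 (h₁ i)) (ZMod (2 ^ e' i)) (x i)
      map_zero' := by funext i; exact map_zero _
      map_add' := fun x y => by funext i; exact map_add _ _ _ }
  refine HasSwitch.of_surjective φ (fun y => ?_) (fun x hx => ?_) ?_ h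
  · choose x hx using fun i => ZMod.castHom_surjective (pow_dvd_pow 2 (h₁ i)) (y i)
    exact ⟨x, funext hx⟩
  · funext i
    have hi : ZMod.castHom (pow_dvd_pow 2 (h₁ i)) (ZMod (2 ^ e' i)) (x i) = 0 := congrFun hx i
    obtain ⟨r, hr⟩ := ZMod.intCast_surjective (x i)
    rw [← hr, map_intCast, ZMod.intCast_zmod_eq_zero_iff_dvd] at hi
    change x i + x i = 0
    rw [← hr, ← Int.cast_add, ZMod.intCast_zmod_eq_zero_iff_dvd]
    obtain ⟨k, rfl⟩ := hi
    refine (Int.natCast_dvd_natCast.2 (pow_dvd_pow 2 (h₂ i))).trans ⟨k, ?_⟩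
    push_cast
    ring
  · rw [hcard, hcard, ← hsum, pow_add, mul_comm]; norm_num

theorem hasSwitch_pair {x y : ℕ} (h : (x = 1 ∧ 2 ≤ y) ∨ (x = 2 ∧ y = 2)) :
    HasSwitch (ZMod (2 ^ x) × ZMod (2 ^ y)) := by
  rcases h with ⟨rfl, h⟩ | ⟨rfl, rfl⟩
  · obtain rfl | h := h.eq_or_lt
    · exact hasSwitch_two_four
    · obtain ⟨n, rfl⟩ : ∃ n, y = n + 3 := ⟨y - 3, by omega⟩
      exact hasSwitch_two_two_pow n
  · exact hasSwitch_four_four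

theorem subsingleton_zmod_two_pow {n : ℕ} (h : n = 0) : Subsingleton (ZMod (2 ^ n)) := by
  subst h; exact inferInstanceAs (Subsingleton (ZMod 1))

/-- Noncyclic abelian `2`-groups that are not elementary have switches. -/
theorem hasSwitch_pi {ι : Type*} [Fintype ι] (e : ι → ℕ) (i j : ι) (hij : i ≠ j) (hi : 1 ≤ e i)
    (hj : 2 ≤ e j) : HasSwitch (∀ i, ZMod (2 ^ e i)) := by
  classical
  induction hs : ∑ l, e l using Nat.strong_induction_on generalizing e i j with
  | _ n ih =>
    -- Induction step: lower the exponents at `k` and `l`, provided that `i'` and `j'` show the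
    -- smaller group to be still noncyclic and nonelementary. The irreducible cases are ℤ/2 × ℤ/2^y
    -- with y ≥ 2, (ℤ/4)², and (ℤ/2)² × ℤ/4.
    have dec : ∀ k l, k ≠ l → 1 ≤ e k → 1 ≤ e l → ∀ i' j', i' ≠ j' →
        1 ≤ e i' - (if i' = k ∨ i' = l then 1 else 0) →
        2 ≤ e j' - (if j' = k ∨ j' = l then 1 else 0) → HasSwitch (∀ i, ZMod (2 ^ e i)) := by
      intro k l hkl hk hl i' j' hij' hi' hj'
      let f : ι → ℕ := fun x => if x = k ∨ x = l then 1 else 0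
      have hf : ∀ x, f x ≤ e x := by
        intro x
        by_cases hx : x = k ∨ x = l
        · simp only [f, hx, if_true]
          rcases hx with rfl | rfl <;> assumption
        · simp [f, hx]
      have hf1 : ∀ x, f x ≤ 1 := by intro x; simp only [f]; split_ifs <;> simp
      have hfs : ∑ x, f x = 2 := by
        simp only [f, Finset.sum_boole, Nat.cast_id]
        rw [Finset.card_eq_two]
        exact ⟨k, l, hkl, by ext x; simp⟩
      have hsum : ∑ x, (e x - f x) + 2 = ∑ x, e x := by
        rw [← hfs, ← Finset.sum_add_distrib]
        exact Finset.sum_congr rfl fun x _ => Nat.sub_add_cancel (hf x)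
      exact HasSwitch.pi_of_sum_eq (e' := fun x => e x - f x) (fun x => Nat.sub_le _ _)
        (fun x => by have := hf1 x; omega) hsum (ih _ (by omega) _ i' j' hij' hi' hj' rfl)
    by_cases hk : ∃ k, k ≠ i ∧ k ≠ j ∧ 1 ≤ e k
    · obtain ⟨k, hki, hkj, hk⟩ := hk
      by_cases hj3 : 3 ≤ e j
      · exact dec i j hij hi (by omega) k j hkj (by simp [hki, hkj, hk]) (by simp; omega)
      by_cases hi2 : 2 ≤ e i
      · exact dec i k hki.symm hi hk i j hij (by simp; omega) (by simp [hij.symm, hkj.symm, hj])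
      by_cases hk2 : 2 ≤ e k
      · exact dec i k hki.symm hi hk k j hkj (by simp; omega) (by simp [hij.symm, hkj.symm, hj])
      by_cases hl : ∃ l, l ≠ i ∧ l ≠ j ∧ l ≠ k ∧ 1 ≤ e l
      · obtain ⟨l, hli, hlj, hlk, hl⟩ := hl
        exact dec i k hki.symm hi hk l j hlj (by simp [hli, hlk, hl])
          (by simp [hij.symm, hkj.symm, hj])
      · push Not at hl
        let φ : (∀ i, ZMod (2 ^ e i)) →+ ZMod (2 ^ e i) × ZMod (2 ^ e k) × ZMod (2 ^ e j) :=
          (Pi.evalAddMonoidHom _ i).prod ((Pi.evalAddMonoidHom _ k).prod (Pi.evalAddMonoidHom _ j))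
        have hφ : Function.Bijective φ := by
          refine ⟨fun x y hxy => funext fun l => ?_, fun ⟨x, y, z⟩ =>
            ⟨Pi.single i x + Pi.single k y + Pi.single j z, ?_⟩⟩
          · have h1 : x i = y i := congrArg Prod.fst hxy
            have h2 : x k = y k := congrArg (fun z => z.2.1) hxy
            have h3 : x j = y j := congrArg (fun z => z.2.2) hxy
            by_cases hli : l = i
            · rw [hli, h1]
            by_cases hlk : l = k
            · rw [hlk, h2]
            by_cases hlj : l = j
            · rw [hlj, h3]
            have := subsingleton_zmod_two_pow (n := e l) (by have := hl l hli hlj hlk; omega)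
            exact Subsingleton.elim _ _
          · simp [φ, hki, hki.symm, hij, hij.symm, hkj, hkj.symm]
        refine HasSwitch.of_addEquiv (AddEquiv.ofBijective φ hφ).symm ?_
        rw [show e i = 1 by omega, show e k = 1 by omega, show e j = 2 by omega]
        exact hasSwitch_two_two_four
    · push Not at hk
      by_cases hd : 2 ≤ e i ∧ (3 ≤ e i ∨ 3 ≤ e j)
      · rcases hd with ⟨hi2, hi3 | hj3⟩
        · exact dec i j hij hi (by omega) j i hij.symm (by simp; omega) (by simp; omega)
        · exact dec i j hij hi (by omega) i j hij (by simp; omega) (by simp; omega)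
      · let φ : (∀ i, ZMod (2 ^ e i)) →+ ZMod (2 ^ e i) × ZMod (2 ^ e j) :=
          (Pi.evalAddMonoidHom _ i).prod (Pi.evalAddMonoidHom _ j)
        have hφ : Function.Bijective φ := by
          refine ⟨fun x y hxy => funext fun l => ?_, fun ⟨x, z⟩ =>
            ⟨Pi.single i x + Pi.single j z, ?_⟩⟩
          · have h1 : x i = y i := congrArg Prod.fst hxy
            have h3 : x j = y j := congrArg Prod.snd hxy
            by_cases hli : l = i
            · rw [hli, h1]
            by_cases hlj : l = j
            · rw [hlj, h3]
            have := subsingleton_zmod_two_pow (n := e l) (by have := hk l hli hlj; omega)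
            exact Subsingleton.elim _ _
          · simp [φ, hij, hij.symm]
        exact HasSwitch.of_addEquiv (AddEquiv.ofBijective φ hφ).symm (hasSwitch_pair (by omega))

theorem ZMod.eq_of_add_self_eq_zero {m : ℕ} (hm : 0 < m) {v : ZMod (2 * m)} (h : v + v = 0)
    (h0 : v ≠ 0) : v = (m : ZMod (2 * m)) := by
  have : NeZero (2 * m) := ⟨by omega⟩
  have hlt := ZMod.val_lt v
  have hpos : 0 < v.val := Nat.pos_of_ne_zero fun h => h0 ((ZMod.val_eq_zero v).1 h)
  have hdvd : 2 * m ∣ v.val + v.val := by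
    rw [← ZMod.natCast_eq_zero_iff]
    push_cast
    rwa [ZMod.natCast_zmod_val]
  obtain ⟨c, hc⟩ := hdvd
  have hc1 : c = 1 := by
    have h1 : 0 < c := Nat.pos_of_ne_zero fun h => by subst h; omega
    have h2 : c < 2 := by
      by_contra h3
      have : 2 * m * 2 ≤ 2 * m * c := Nat.mul_le_mul_left _ (by omega)
      omega
    omega
  rw [← ZMod.natCast_zmod_val v, show v.val = m by subst hc1; omega]

theorem hasSwitch_of_two_group {P : Type*} [AddCommGroup P] [Finite P] {k : ℕ}
    (hP : ∀ x : P, 2 ^ k • x = 0) {a b x : P} (ha : a + a = 0) (hb : b + b = 0) (ha0 : a ≠ 0)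
    (hb0 : b ≠ 0) (hab : a ≠ b) (hx : x + x ≠ 0) : HasSwitch P := by
  classical
  obtain ⟨ι, _, n, -, ⟨f⟩⟩ := AddCommGroup.equiv_directSum_zmod_of_finite' P
  replace f := f.trans (DirectSum.addEquivProd fun i => ZMod (n i))
  have hn : ∀ i, ∃ e, n i = 2 ^ e := by
    intro i
    have h := congrFun ((map_nsmul f (2 ^ k) (f.symm (Pi.single i 1))).symm.trans
      (by rw [hP, map_zero])) i
    rw [AddEquiv.apply_symm_apply, Pi.smul_apply, Pi.single_eq_same, nsmul_one,
      Pi.zero_apply, ZMod.natCast_eq_zero_iff] at h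
    obtain ⟨e, -, he⟩ := (Nat.dvd_prime_pow Nat.prime_two).1 h
    exact ⟨e, he⟩
  choose e he using hn
  obtain rfl : n = fun i => 2 ^ e i := funext he
  refine HasSwitch.of_addEquiv f.symm ?_
  obtain ⟨j, hj⟩ : ∃ j, f x j + f x j ≠ 0 := by
    by_contra! h
    exact hx (f.injective (by rw [map_add, map_zero]; exact funext h))
  have hj2 : 2 ≤ e j := by
    by_contra h
    refine hj ?_
    rw [← two_mul, ← Nat.cast_two (R := ZMod (2 ^ e j)),
      (ZMod.natCast_eq_zero_iff 2 (2 ^ e j)).2 (by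
        simpa using pow_dvd_pow 2 (show e j ≤ 1 by omega)), zero_mul]
  -- With only one nontrivial coordinate the group would be cyclic and have at most one involution,
  -- contrary to `a ≠ b`.
  obtain ⟨i, hij, hi⟩ : ∃ i, i ≠ j ∧ 1 ≤ e i := by
    by_contra! h
    have hsub : ∀ i, i ≠ j → Subsingleton (ZMod (2 ^ e i)) := fun i hi =>
      subsingleton_zmod_two_pow (by have := h i hi; omega)
    have hext : ∀ u v : P, f u j = f v j → u = v := by
      intro u v huv
      refine f.injective (funext fun i => ?_)
      by_cases hi : i = j
      · rw [hi, huv]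
      · have := hsub i hi
        exact Subsingleton.elim _ _
    obtain ⟨d, hd⟩ : ∃ d, e j = d + 1 := ⟨e j - 1, by omega⟩
    have huniq : ∀ u v : ZMod (2 ^ e j), u + u = 0 → v + v = 0 → u ≠ 0 → v ≠ 0 → u = v := by
      rw [hd, pow_succ']
      intro u v hu hv hu0 hv0
      rw [ZMod.eq_of_add_self_eq_zero (by positivity) hu hu0,
        ZMod.eq_of_add_self_eq_zero (by positivity) hv hv0]
    have hdbl : ∀ u : P, u + u = 0 → f u j + f u j = 0 := fun u hu => by
      rw [← Pi.add_apply, ← map_add, hu, map_zero, Pi.zero_apply]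
    have hne : ∀ u : P, u ≠ 0 → f u j ≠ 0 := fun u hu h0 =>
      hu (hext u 0 (by rw [h0, map_zero, Pi.zero_apply]))
    exact hab (hext a b (huniq _ _ (hdbl a ha) (hdbl b hb) (hne a ha0) (hne b hb0)))
  exact hasSwitch_pi e i j hij hi hj2

/-! ### Assembling the cases. -/

theorem odd_card_of_nsmul_eq_zero {A : Type*} [AddCommGroup A] [Finite A] {m : ℕ} (hm : Odd m)
    (h : ∀ x : A, m • x = 0) : Odd (Nat.card A) := by
  by_contra hA
  rw [Nat.not_odd_iff_even, even_iff_two_dvd] at hA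
  obtain ⟨x, hx⟩ := exists_prime_addOrderOf_dvd_card' 2 hA
  have := addOrderOf_dvd_of_nsmul_eq_zero (h x)
  rw [hx] at this
  exact Nat.not_even_iff_odd.2 hm (even_iff_two_dvd.2 this)

theorem AddMonoidHom.card_ker_mul_card {A B : Type*} [AddCommGroup A] [AddCommGroup B]
    (φ : A →+ B) (hφ : Function.Surjective φ) :
    Nat.card φ.ker * Nat.card B = Nat.card A := by
  rw [← Nat.card_congr (QuotientAddGroup.quotientKerEquivOfSurjective φ hφ).toEquiv, mul_comm]
  exact (AddSubgroup.card_eq_card_quotient_mul_card_addSubgroup φ.ker).symm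

/-- An element of odd prime order p, together with the kernel, generates a subgroup kernel × ℤ/p
whose quotient again has odd order. -/
theorem harmonic_of_elementary_ker {A B : Type*} [AddCommGroup A] [AddCommGroup B] [Finite A]
    (φ : A →+ B) (hφ : Function.Surjective φ) (hodd : Odd (Nat.card B)) (h1 : Nat.card B ≠ 1)
    (hK : ∀ x : φ.ker, x + x = 0) (h4 : 4 ≤ Nat.card φ.ker) : Harmonic A := by
  obtain ⟨p, hp, hpB⟩ := Nat.exists_prime_and_dvd h1
  have hp2 : p ≠ 2 := by
    rintro rfl
    exact Nat.not_even_iff_odd.2 hodd (even_iff_two_dvd.2 hpB)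
  have hcard := φ.card_ker_mul_card hφ
  have : Fact p.Prime := ⟨hp⟩
  obtain ⟨w, hw⟩ := exists_prime_addOrderOf_dvd_card' (G := A) p (hcard ▸ hpB.mul_left _)
  let g : ZMod p →+ A := ZMod.lift p ⟨zmultiplesHom A w, by
    rw [zmultiplesHom_apply, natCast_zsmul, ← hw]; exact addOrderOf_nsmul_eq_zero w⟩
  have hg : ∀ r : ℤ, g r = r • w := fun r => by simp [g]
  let f : φ.ker × ZMod p →+ A := φ.ker.subtype.coprod g
  have hf : Function.Injective f := by
    rw [injective_iff_map_eq_zero]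
    rintro ⟨x, j⟩ hxj
    obtain ⟨r, rfl⟩ := ZMod.intCast_surjective j
    have hxj : (x : A) + r • w = 0 := by rw [← hg]; exact hxj
    have hx : (x : A) + x = 0 := congrArg Subtype.val (hK x)
    have h2 : (2 * r) • w = 0 := by
      rw [two_mul, add_zsmul]
      calc r • w + r • w = ((x : A) + r • w) + (x + r • w) - (x + x) := by abel
        _ = 0 := by rw [hxj, hx]; simp
    have hpr : (p : ℤ) ∣ r := by
      have h3 := addOrderOf_dvd_iff_zsmul_eq_zero.2 h2
      rw [hw] at h3
      rcases (Nat.prime_iff_prime_int.1 hp).dvd_or_dvd h3 with h | h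
      · exact absurd ((Nat.prime_dvd_prime_iff_eq hp Nat.prime_two).1 (by exact_mod_cast h)) hp2
      · exact h
    have hr := addOrderOf_dvd_iff_zsmul_eq_zero.1 (hw ▸ hpr)
    rw [hr, add_zero] at hxj
    exact Prod.ext (Subtype.ext hxj) ((ZMod.intCast_zmod_eq_zero_iff_dvd r p).2 hpr)
  let π := QuotientAddGroup.mk' f.range
  have hπ : Function.Surjective π := QuotientAddGroup.mk'_surjective _
  have hπk : π.ker = f.range := QuotientAddGroup.ker_mk' _
  refine Harmonic.of_ker_of_odd_card π hπ ?_ ?_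
  · rw [hπk]
    exact (harmonic_elementary_prod hp hp2 hK h4).of_addEquiv (AddMonoidHom.ofInjective hf)
  · have h := π.card_ker_mul_card hπ
    rw [hπk, ← Nat.card_congr (AddMonoidHom.ofInjective hf).toEquiv, Nat.card_prod,
      Nat.card_zmod, ← hcard, mul_assoc] at h
    have h' := Nat.eq_of_mul_eq_mul_left (by omega) h
    exact (Nat.odd_mul.1 (h' ▸ hodd)).2

theorem CycleCondition.harmonic {A : Type*} [AddCommGroup A] [Finite A]
    (h : CycleCondition A (Nat.card A)) : Harmonic A := by
  rcases h with hodd | ⟨heven, s, hs, K, ⟨f⟩⟩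
  · exact Harmonic.of_odd_card A hodd
  obtain ⟨k, m, hm, hkm⟩ := Nat.exists_eq_two_pow_mul_odd (n := Nat.card A) Nat.card_pos.ne'
  -- Multiplication by 2^k, the full power of 2 in the group order: its kernel is the Sylow
  -- 2-subgroup and its image has odd order.
  let φ := (nsmulAddMonoidHom (α := A) (2 ^ k)).rangeRestrict
  have hφ : Function.Surjective φ := AddMonoidHom.rangeRestrict_surjective _
  have hker : ∀ x : A, x ∈ φ.ker ↔ 2 ^ k • x = 0 := by
    intro x
    rw [AddMonoidHom.ker_rangeRestrict, AddMonoidHom.mem_ker]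
    rfl
  have hodd : Odd (Nat.card (nsmulAddMonoidHom (α := A) (2 ^ k)).range) := by
    refine odd_card_of_nsmul_eq_zero hm ?_
    rintro ⟨-, x, rfl⟩
    refine Subtype.ext ?_
    change m • 2 ^ k • x = 0
    rw [smul_smul, mul_comm, ← hkm]
    exact card_nsmul_eq_zero'
  let g : ZMod 2 × ZMod (2 * s) →+ A := K.subtype.comp f.symm.toAddMonoidHom
  have hg : Function.Injective g := K.subtype_injective.comp f.symm.injective
  have h2k : 2 ∣ 2 ^ k := by
    refine dvd_pow_self 2 ?_
    rintro rfl
    rw [pow_zero, one_mul] at hkm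
    exact Nat.not_even_iff_odd.2 hm (hkm ▸ heven)
  have hmem : ∀ x : A, x + x = 0 → x ∈ φ.ker := by
    intro x hx
    obtain ⟨c, hc⟩ := h2k
    rw [hker, hc, mul_comm, mul_smul, two_nsmul, hx, smul_zero]
  have hs0 : ((s : ℕ) : ZMod (2 * s)) ≠ 0 := by
    rw [Ne, ZMod.natCast_eq_zero_iff]
    exact fun h => by have := Nat.le_of_dvd (by omega) h; omega
  have hss : ((s : ℕ) : ZMod (2 * s)) + s = 0 := by
    rw [← Nat.cast_add, ← two_mul, ZMod.natCast_self]
  have h11 : (1 : ZMod 2) + 1 = 0 := rfl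
  have ha : g (1, 0) + g (1, 0) = 0 := by
    rw [← map_add, Prod.mk_add_mk, h11, add_zero]; exact map_zero g
  have hb : g (0, s) + g (0, s) = 0 := by
    rw [← map_add, Prod.mk_add_mk, hss, add_zero]; exact map_zero g
  have ha0 : g (1, 0) ≠ 0 := (map_ne_zero_iff g hg).2 fun h => one_ne_zero (congrArg Prod.fst h)
  have hb0 : g (0, s) ≠ 0 := (map_ne_zero_iff g hg).2 fun h => hs0 (congrArg Prod.snd h)
  have hab : g (1, 0) ≠ g (0, s) := hg.ne fun h => one_ne_zero (congrArg Prod.fst h)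
  let a : φ.ker := ⟨g (1, 0), hmem _ ha⟩
  let b : φ.ker := ⟨g (0, s), hmem _ hb⟩
  have ha' : a + a = 0 := Subtype.ext ha
  have hb' : b + b = 0 := Subtype.ext hb
  have ha0' : a ≠ 0 := fun h => ha0 (congrArg Subtype.val h)
  have hb0' : b ≠ 0 := fun h => hb0 (congrArg Subtype.val h)
  have hab' : a ≠ b := fun h => hab (by have h := congrArg Subtype.val h; exact h)
  by_cases hP : ∀ x : φ.ker, x + x = 0
  -- The odd part is nontrivial: otherwise the whole group would have exponent 2, although the image
  -- of (0, 1) has order 2s > 2.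
  · refine harmonic_of_elementary_ker φ hφ hodd (fun h1 => ?_) hP ?_
    · have := (Nat.card_eq_one_iff_unique.1 h1).1
      have hall : ∀ x : A, x + x = 0 := fun x =>
        congrArg Subtype.val (hP ⟨x, AddMonoidHom.mem_ker.2 (Subsingleton.elim _ _)⟩)
      have h := hall (g (0, 1))
      rw [← map_add, map_eq_zero_iff g hg] at h
      have h : (1 : ZMod (2 * s)) + 1 = 0 := congrArg Prod.snd h
      have h : ((2 : ℕ) : ZMod (2 * s)) = 0 := by rw [← h]; norm_num
      rw [ZMod.natCast_eq_zero_iff] at h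
      have := Nat.le_of_dvd (by omega) h
      omega
    · classical
      have : Fintype φ.ker := Fintype.ofFinite _
      have hab0 : a + b ≠ 0 := fun h => hab' (by
        rw [eq_neg_of_add_eq_zero_left h, ← eq_neg_of_add_eq_zero_left hb'])
      have hcard : ({0, a, b, a + b} : Finset φ.ker).card = 4 := by
        rw [Finset.card_insert_of_notMem, Finset.card_insert_of_notMem, Finset.card_pair]
        · simpa using ha0'
        · simpa using ⟨hab', hb0'⟩
        · simpa using ⟨ha0'.symm, hb0'.symm, hab0.symm⟩
      rw [Nat.card_eq_fintype_card, ← hcard]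
      exact Finset.card_le_univ _
  · push Not at hP
    obtain ⟨x, hx⟩ := hP
    refine Harmonic.of_ker_of_odd_card φ hφ (HasSwitch.harmonic ?_) hodd
    exact hasSwitch_of_two_group (k := k) (fun y => Subtype.ext ((hker y).1 y.2)) ha' hb' ha0' hb0'
      hab' hx

theorem mainTheorem2 (k n : ℕ) (hn : 3 ≤ n) (Γ : Type*) [AddCommGroup Γ]
    (hΓ : Nat.card Γ = n * (k + 1)) (H : AddSubgroup Γ) (hH : Nat.card H = n)
    (hcond : CycleCondition H n) :
    IsHarmonious (superwheel k n) Γ ∧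
      ∃ (h : Fin n → H) (g : Fin k → Γ),
        IsHarmoniousLabeling (SimpleGraph.cycleGraph n) h ∧
        Set.BijOn (fun j => (QuotientAddGroup.mk (g j) : Γ ⧸ H)) Set.univ {0}ᶜ ∧
        IsHarmoniousLabeling (superwheel k n) (Sum.elim (fun i => (h i : Γ)) g) := by
  have hfin : Finite H := Nat.finite_of_card_ne_zero (by omega)
  obtain ⟨h, hh⟩ := Harmonic.exists_labeling (by omega) hH
    (CycleCondition.harmonic (hH.symm ▸ hcond))
  obtain ⟨g, hg⟩ := exists_coset_representatives (by omega) hΓ H hH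
  have hl := superwheel_labeling H hfin hH hh hg
  exact ⟨⟨_, hl⟩, h, g, hh, hg, hl⟩
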